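/- Let $(\Omega,\mu)$ be a probability space and let $T:\Omega\to\Omega$ be a measurable map for which $\mu$ is invariant and ergodic. Let $\mathcal A$ be a finite or countably infinite measurable partition of $\Omega$ which is generating, that is, up to null sets the measurable sets are generated by the partitions $T^{-i}\mathcal A$ with $i\ge 0$ (or, when $T$ is invertible with measurable inverse, with $i\in\mathbb Z$). Let $h_\mu\in[0,\infty]$ be the measure theoretic (Kolmogorov–Sinai) entropy of $T$ with respect to $\mu$. If $h_\mu<\infty$, assume that $\mathcal A$ has finite entropy, $-\sum_{A\in\mathcal A}\mu(A)\log\mu(A)<\infty$ (which is automatic when $\mathcal A$ is finite). For $z\in\Omega$ and $n\ge 1$ let $A_n(z)$ be the element of $\bigvee_{i=0}^{n-1}T^{-i}\mathcal A$ that contains $z$. For $A\subset\Omega$ let $\tau_A(x)=\min\{i\ge 1: T^i(x)\in A\}$, with $\tau_A(x)=\infty$ if there is no such $i$, and for $t>0$ put $$F_z^n(t)=\mu\Big(\Big\{x\in\Omega:\ \tau_{A_n(z)}(x)\ge \frac{t}{\mu(A_n(z))}\Big\}\Big).$$ Suppose that for $\mu$-almost every $z\in\Omega$ there exist a decreasing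 (i.e. non-increasing) real function $F_z(t)$ of $t>0$, with $z\mapsto F_z(t)$ measurable for each $t>0$, and a summable sequence $a_n=a_n(z)>0$ (which may, but need not, depend on $z$), such that for all small enough $\varepsilon>0$ (i) $\displaystyle\sum_{n=1}^\infty \mu\big(\{z:\ |F_z^n(e^{n\varepsilon})-F_z(e^{n\varepsilon})|>a_n(z)\}\big)<\infty$, and (ii) $\displaystyle\sum_{n=1}^\infty\int_\Omega F_z(e^{n\varepsilon})\,d\mu(z)<\infty$. (In (ii) the integrand may be replaced by its positive part: this changes nothing, because (i) forces $F_z\ge 0$ for almost every $z$. In (i), $\mu$ is the outer measure if the set is not measurable.) Then $$\lim_{n\to\infty}\frac1n\log\tau_{A_n(z)}(x)=h_\mu$$ for $\mu\times\mu$-almost every $(x,z)\in\Omega\times\Omega$. -/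

import Mathlib

open MeasureTheory Filter Topology Set
open scoped ENNReal

noncomputable section

namespace EntranceTime

/- Throughout, a finite or countably infinite measurable partition `𝒜` of `Ω` is presented by its
labelling map `P : Ω → ι`, a measurable map to a countable discrete space: the elements of `𝒜` are
the (non-empty) fibres `P ⁻¹' {i}`, and two points lie in the same element iff `P` agrees on them. -/

variable {Ω : Type*} {ι : Type*}

/-- The labelling map of the `n`-th join `𝒜ⁿ = ⋁_{0 ≤ i < n} T⁻ⁱ 𝒜`. -/
def itinerary (T : Ω → Ω) (P : Ω → ι) (n : ℕ) (x : Ω) : Fin n → ι :=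
  fun i => P (T^[i] x)

/-- The `n`-cylinder `A_n(z)`: the element of `𝒜ⁿ` which contains `z`. -/
def cylinder (T : Ω → Ω) (P : Ω → ι) (n : ℕ) (z : Ω) : Set Ω :=
  {y | ∀ i < n, P (T^[i] y) = P (T^[i] z)}

/-- The entrance time `τ_A(x) = min {i ≥ 1 : Tⁱ x ∈ A}`, equal to `∞` if the orbit of `x` never
enters `A`. -/
def entranceTime (T : Ω → Ω) (A : Set Ω) (x : Ω) : ℕ∞ :=
  ⨅ (i : ℕ) (_ : 1 ≤ i ∧ T^[i] x ∈ A), (i : ℕ∞)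

/-- The entrance times distribution `F_z^n(t) = μ {x : τ_{A_n(z)}(x) ≥ t / μ(A_n(z))}`. -/
def entranceDist [MeasurableSpace Ω] (μ : Measure Ω) (T : Ω → Ω) (P : Ω → ι)
    (n : ℕ) (z : Ω) (t : ℝ) : ℝ :=
  (μ {x | ENNReal.ofReal t / μ (cylinder T P n z) ≤
    ((entranceTime T (cylinder T P n z) x : ℕ∞) : ℝ≥0∞)}).toReal

/-- The Shannon entropy `H_μ(𝒜) = - ∑_{A ∈ 𝒜} μ(A) log μ(A) ∈ [0, ∞]` of a partition. -/
def partitionEntropy [MeasurableSpace Ω] (μ : Measure Ω) (P : Ω → ι) : ℝ≥0∞ :=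
  ∑' i, ENNReal.ofReal (Real.negMulLog (μ (P ⁻¹' {i})).toReal)

/-- The entropy `h_μ(T, 𝒜) = lim_n (1/n) H_μ(𝒜ⁿ)` of `T` with respect to a partition. (For invariant
`μ` the limit exists by subadditivity.) -/
def entropyRate [MeasurableSpace Ω] (μ : Measure Ω) (T : Ω → Ω) (P : Ω → ι) : ℝ≥0∞ :=
  limsup (fun n : ℕ => partitionEntropy μ (itinerary T P n) / (n : ℝ≥0∞)) atTop

/-- The measure theoretic (Kolmogorov–Sinai) entropy `h_μ ∈ [0, ∞]` of `T`: the supremum of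
`h_μ(T, 𝒬)` over all finite measurable partitions `𝒬` of `Ω`. -/
def metricEntropy [MeasurableSpace Ω] (μ : Measure Ω) (T : Ω → Ω) : ℝ≥0∞ :=
  ⨆ (k : ℕ) (Q : Ω → Fin k) (_ : Measurable Q), entropyRate μ T Q

/-- The sub-`σ`-algebra `m` is the whole `σ`-algebra up to `μ`-null sets. -/
def IsFullModNull {m₀ : MeasurableSpace Ω} (μ : Measure Ω) (m : MeasurableSpace Ω) : Prop :=
  ∀ B : Set Ω, MeasurableSet[m₀] B → ∃ C : Set Ω, MeasurableSet[m] C ∧ B =ᵐ[μ] C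

/-- The partition is generating for `T`: up to null sets, the measurable sets are generated by the
partitions `T⁻ⁱ 𝒜`, `i ≥ 0`, or, if `T` is invertible, by the partitions `T⁻ⁱ 𝒜`, `i ∈ ℤ`. -/
def IsGenerating [MeasurableSpace Ω] [MeasurableSpace ι] (μ : Measure Ω) (T : Ω → Ω) (P : Ω → ι) :
    Prop :=
  IsFullModNull μ (⨆ i : ℕ, MeasurableSpace.comap (fun x => P (T^[i] x)) inferInstance) ∨
  ∃ e : Ω ≃ᵐ Ω, (∀ x, e x = T x) ∧
    IsFullModNull μ ((⨆ i : ℕ, MeasurableSpace.comap (fun x => P (T^[i] x)) inferInstance) ⊔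
      (⨆ i : ℕ, MeasurableSpace.comap (fun x => P (e.symm^[i] x)) inferInstance))

end EntranceTime

end

set_option linter.unusedSectionVars false

/-! Both bounds are Borel–Cantelli arguments in x for fixed z, fed with the exponential decay rate
of μ(A_n(z)). Below: invariance and a union bound give μ(τ_A ≤ s) ≤ s μ(A)
(`measure_entranceTime_le`), so if μ(A_n(z)) ≤ e^{-nr} and q < r, the events τ ≤ e^{nq} have
summable measures. Above: the event τ ≥ e^{nε}/μ(A_n(z)) has measure F_z^n(e^{nε}). By (i), the
summability of a_n and Tonelli in (ii), these are summable for almost every z, so eventually τ <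
e^{n(r+ε)} once μ(A_n(z)) ≥ e^{-nr}. Fubini combines the two.

The decay rate is the Shannon–McMillan–Breiman theorem, proved as two one-sided inequalities: the
lower one uses the generator, the upper one uses finite entropy and is void when h_μ = ∞. Both rest
on Birkhoff's theorem and on Markov's inequality in the form `ae_eventually_le_sq`. For a finite
partition let p(x) be the conditional probability of the label of x given the labels of T x, T² x,
…. Then μ(A_n(x)) / ∏ p(Tⁱx) has integral at most 1 (`lintegral_mul_prod_predProb_inv_le`), so -log
μ(A_n) is at least the Birkhoff sum of -log p up to O(log n); the mean of -log p is the entropy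
rate, by the chain rule and martingale convergence. For the upper half, a sub-probability weight on
words is divided by μ(A_n): the weight is a Markov approximation of order k of a finite coarsening φ
∘ P, spread over the finer labels. Its surprise is a Birkhoff sum up to a boundary term, and its
mean tends to h(φ ∘ P) + H(P) - H(φ ∘ P) as k → ∞.

To reach the Kolmogorov–Sinai entropy from below, a finite partition R is approximated, after a
shift, by a function S of finitely many labels of P, and h(R) ≤ h(S) + H(R | S), which follows from
the two halves themselves. From above, φ is chosen with H(P) - H(φ ∘ P) small. -/

noncomputable section

namespace EntranceTime

/-! ### Birkhoff's ergodic theorem -/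

section Birkhoff

variable {Ω : Type*} {T : Ω → Ω} {f : Ω → ℝ}

/-- The maximum of the Birkhoff sums `S₁, …, Sₙ₊₁` of `f`. -/
def maxBirkhoffSum (T : Ω → Ω) (f : Ω → ℝ) : ℕ → Ω → ℝ
  | 0, x => f x
  | n + 1, x => f x + max 0 (maxBirkhoffSum T f n (T x))

lemma maxBirkhoffSum_le_succ (n : ℕ) (x : Ω) :
    maxBirkhoffSum T f n x ≤ maxBirkhoffSum T f (n + 1) x := by
  induction n generalizing x with
  | zero => simp [maxBirkhoffSum]
  | succ n ih =>
    rw [maxBirkhoffSum, maxBirkhoffSum]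
    gcongr
    exact ih _

lemma monotone_maxBirkhoffSum (x : Ω) : Monotone fun n => maxBirkhoffSum T f n x :=
  monotone_nat_of_le_succ fun n => maxBirkhoffSum_le_succ n x

lemma birkhoffSum_le_maxBirkhoffSum (n : ℕ) (x : Ω) :
    birkhoffSum T f (n + 1) x ≤ maxBirkhoffSum T f n x := by
  induction n generalizing x with
  | zero => simp [maxBirkhoffSum]
  | succ n ih =>
    rw [birkhoffSum_succ', maxBirkhoffSum]
    gcongr
    exact (ih _).trans (le_max_right _ _)

variable [MeasurableSpace Ω] {μ : Measure Ω}

lemma integral_comp_of_measurePreserving (hT : MeasurePreserving T μ μ)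
    (hf : AEStronglyMeasurable f μ) : ∫ x, f (T x) ∂μ = ∫ x, f x ∂μ := by
  rw [← integral_map hT.measurable.aemeasurable (by rwa [hT.map_eq]), hT.map_eq]

lemma integrable_maxBirkhoffSum (hT : MeasurePreserving T μ μ) (hfi : Integrable f μ) (n : ℕ) :
    Integrable (maxBirkhoffSum T f n) μ := by
  induction n with
  | zero => exact hfi
  | succ n ih =>
    have h : Integrable (fun x => maxBirkhoffSum T f n (T x)) μ := hT.integrable_comp_of_integrable ih
    exact hfi.add ((integrable_zero _ _ _).sup h)

lemma measurable_maxBirkhoffSum (hT : Measurable T) (hf : Measurable f) (n : ℕ) :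
    Measurable (maxBirkhoffSum T f n) := by
  induction n with
  | zero => exact hf
  | succ n ih => exact hf.add (measurable_const.max (ih.comp hT))

/-- The set of bounded maxima M_n is invariant, so by ergodicity it is null or conull. Were it null,
M_{n+1} - M_n ∘ T would tend to f, although its integral is nonnegative by invariance and
monotonicity; this contradicts ∫ f < 0. -/
lemma ae_bddAbove_maxBirkhoffSum [IsProbabilityMeasure μ] (hT : Ergodic T μ) (hf : Measurable f)
    (hfi : Integrable f μ) (hneg : ∫ x, f x ∂μ < 0) :
    ∀ᵐ x ∂μ, BddAbove (range fun n => maxBirkhoffSum T f n x) := by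
  set E : Set Ω := {x | BddAbove (range fun n => maxBirkhoffSum T f n x)}
  have hE : MeasurableSet E :=
    measurableSet_bddAbove_range fun n => measurable_maxBirkhoffSum hT.measurable hf n
  have hinv : T ⁻¹' E = E := by
    ext x
    simp only [E, mem_preimage, mem_ofPred_eq, bddAbove_def, forall_mem_range]
    constructor
    · rintro ⟨C, hC⟩
      refine ⟨f x + max 0 C, fun n => (maxBirkhoffSum_le_succ n x).trans ?_⟩
      rw [maxBirkhoffSum]
      gcongr
      exact hC n
    · rintro ⟨C, hC⟩
      refine ⟨C - f x, fun n => ?_⟩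
      have := hC (n + 1)
      rw [maxBirkhoffSum] at this
      linarith [le_max_right 0 (maxBirkhoffSum T f n (T x))]
  rcases hT.ae_mem_or_ae_notMem hE hinv with h | h
  · exact h
  exfalso
  have hTx : ∀ᵐ x ∂μ, T x ∉ E := hT.quasiMeasurePreserving.ae h
  -- The integrand is f plus the negative part of M_n ∘ T, which vanishes once M_n(T x) ≥ 0. Since
  -- M_n ≥ f, it is dominated by |f| + |f ∘ T|.
  have hlim : Tendsto (fun n => ∫ x, (maxBirkhoffSum T f (n + 1) x - maxBirkhoffSum T f n (T x)) ∂μ)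
      atTop (𝓝 (∫ x, f x ∂μ)) := by
    refine tendsto_integral_of_dominated_convergence (fun x => |f x| + |f (T x)|) ?_ ?_ ?_ ?_
    · intro n
      exact ((measurable_maxBirkhoffSum hT.measurable hf _).sub
        ((measurable_maxBirkhoffSum hT.measurable hf _).comp hT.measurable)).aestronglyMeasurable
    · exact hfi.abs.add (hT.toMeasurePreserving.integrable_comp_of_integrable hfi.abs)
    · intro n
      refine Eventually.of_forall fun x => ?_
      have h0 : f (T x) ≤ maxBirkhoffSum T f n (T x) :=
        monotone_maxBirkhoffSum (T := T) (f := f) (T x) (Nat.zero_le n)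
      rw [maxBirkhoffSum, Real.norm_eq_abs, add_sub_assoc]
      refine (abs_add_le _ _).trans (add_le_add le_rfl ?_)
      rcases le_total 0 (maxBirkhoffSum T f n (T x)) with h1 | h1
      · simp [max_eq_right h1]
      · rw [max_eq_left h1, zero_sub, abs_neg, abs_of_nonpos h1, abs_of_nonpos (h0.trans h1)]
        linarith
    · filter_upwards [hTx] with x hx
      refine tendsto_const_nhds.congr' ?_
      have : Tendsto (fun n => maxBirkhoffSum T f n (T x)) atTop atTop :=
        tendsto_atTop_atTop_of_monotone' (monotone_maxBirkhoffSum _) hx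
      filter_upwards [this.eventually_ge_atTop 0] with n hn
      rw [maxBirkhoffSum, max_eq_right hn]
      ring
  have hge : ∀ n, 0 ≤ ∫ x, (maxBirkhoffSum T f (n + 1) x - maxBirkhoffSum T f n (T x)) ∂μ := by
    intro n
    have hi := integrable_maxBirkhoffSum hT.toMeasurePreserving hfi
    rw [integral_sub (hi _) (g := fun x => maxBirkhoffSum T f n (T x))
      (hT.toMeasurePreserving.integrable_comp_of_integrable (hi n)),
      integral_comp_of_measurePreserving hT.toMeasurePreserving (hi n).aestronglyMeasurable,
      sub_nonneg]
    exact integral_mono (hi _) (hi _) fun x => maxBirkhoffSum_le_succ n x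
  exact absurd (ge_of_tendsto' hlim hge) (not_le.2 hneg)

/-- Subtracting d with ∫ f < d < c makes the mean negative, so the sums of f - d stay bounded while
n(c - d) → ∞. -/
lemma ae_eventually_birkhoffSum_lt [IsProbabilityMeasure μ] (hT : Ergodic T μ) (hf : Measurable f)
    (hfi : Integrable f μ) {c : ℝ} (hc : ∫ x, f x ∂μ < c) :
    ∀ᵐ x ∂μ, ∀ᶠ n : ℕ in atTop, birkhoffSum T f n x < n * c := by
  obtain ⟨d, hd, hdc⟩ := exists_between hc
  have hi : Integrable (fun x => f x - d) μ := hfi.sub (integrable_const _)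
  have := ae_bddAbove_maxBirkhoffSum hT (hf.sub_const d) hi
    (by rw [integral_sub hfi (integrable_const _)]; simpa using hd)
  filter_upwards [this] with x hx
  obtain ⟨C, hC⟩ := hx
  rw [mem_upperBounds, forall_mem_range] at hC
  have hlin : Tendsto (fun n : ℕ => (n : ℝ) * (c - d)) atTop atTop :=
    tendsto_natCast_atTop_atTop.atTop_mul_const (sub_pos.2 hdc)
  filter_upwards [hlin.eventually_gt_atTop C, eventually_ge_atTop 1] with n hn h1
  obtain ⟨m, rfl⟩ : ∃ m, n = m + 1 := ⟨n - 1, by omega⟩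
  have h2 := (birkhoffSum_le_maxBirkhoffSum (T := T) (f := fun x => f x - d) m x).trans (hC m)
  have h3 : birkhoffSum T (fun x => f x - d) (m + 1) x
      = birkhoffSum T f (m + 1) x - (m + 1 : ℕ) * d := by
    simp [birkhoffSum, Finset.sum_sub_distrib]
  rw [h3] at h2
  linarith

/-- Birkhoff's pointwise ergodic theorem for ergodic maps. -/
theorem ae_tendsto_birkhoffSum_div [IsProbabilityMeasure μ] (hT : Ergodic T μ) (hf : Measurable f)
    (hfi : Integrable f μ) :
    ∀ᵐ x ∂μ, Tendsto (fun n : ℕ => birkhoffSum T f n x / n) atTop (𝓝 (∫ x, f x ∂μ)) := by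
  set I := ∫ x, f x ∂μ
  have hup : ∀ m : ℕ, ∀ᵐ x ∂μ, ∀ᶠ n : ℕ in atTop,
      birkhoffSum T f n x < n * (I + 1 / ((m : ℝ) + 1)) := fun m =>
    ae_eventually_birkhoffSum_lt hT hf hfi (lt_add_of_pos_right _ (by positivity))
  have hlo : ∀ m : ℕ, ∀ᵐ x ∂μ, ∀ᶠ n : ℕ in atTop,
      birkhoffSum T (fun y => -f y) n x < n * (-I + 1 / ((m : ℝ) + 1)) := fun m =>
    ae_eventually_birkhoffSum_lt hT hf.neg hfi.neg
      (by rw [integral_neg']; exact lt_add_of_pos_right _ (by positivity))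
  filter_upwards [ae_all_iff.2 hup, ae_all_iff.2 hlo] with x hx1 hx2
  rw [Metric.tendsto_nhds]
  intro ε hε
  obtain ⟨m, hm⟩ := exists_nat_one_div_lt hε
  filter_upwards [hx1 m, hx2 m, eventually_gt_atTop 0] with n h1 h2 h3
  have h3' : (0 : ℝ) < n := by exact_mod_cast h3
  have h4 : birkhoffSum T (fun y => -f y) n x = -birkhoffSum T f n x := by
    simp [birkhoffSum]
  rw [h4] at h2
  rw [Real.dist_eq, abs_lt]
  constructor
  · rw [lt_sub_iff_add_lt, lt_div_iff₀ h3']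
    nlinarith
  · rw [sub_lt_iff_lt_add, div_lt_iff₀ h3']
    nlinarith

end Birkhoff

/-! ### Information functions and Shannon entropy -/

section Information

variable {Ω α β : Type*} [MeasurableSpace Ω] {μ : Measure Ω}

/-- The information function `x ↦ -log μ(X = X x)` of the partition into the fibres of `X`. -/
def info (μ : Measure Ω) (X : Ω → α) (x : Ω) : ℝ := -Real.log (μ.real (X ⁻¹' {X x}))

/-- The Shannon entropy of a partition as the real integral of its information function. -/
def entropy (μ : Measure Ω) (X : Ω → α) : ℝ := ∫ x, info μ X x ∂μ

lemma info_nonneg [IsProbabilityMeasure μ] (X : Ω → α) (x : Ω) : 0 ≤ info μ X x :=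
  neg_nonneg.2 (Real.log_nonpos measureReal_nonneg measureReal_le_one)

lemma info_comp_injective (X : Ω → α) {e : α → β} (he : e.Injective) :
    info μ (fun x => e (X x)) = info μ X := by
  funext x
  unfold info
  congr 3
  ext y
  simp [he.eq_iff]

lemma measurable_info [MeasurableSpace α] [DiscreteMeasurableSpace α] {X : Ω → α}
    (hX : Measurable X) : Measurable (info μ X) :=
  (Measurable.of_discrete (f := fun a => -Real.log (μ.real (X ⁻¹' {a})))).comp hX

section Countable

variable [Countable α]

/-- Null fibres have to be discarded because `Real.log 0 = 0` gives them information 0 instead of ∞.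
-/
lemma ae_measure_fibre_ne_zero (X : Ω → α) :
    ∀ᵐ x ∂μ, μ (X ⁻¹' {X x}) ≠ 0 := by
  have h : ∀ᵐ x ∂μ, ∀ a, μ (X ⁻¹' {a}) = 0 → X x ≠ a := by
    rw [ae_all_iff]
    intro a
    by_cases ha : μ (X ⁻¹' {a}) = 0
    · have : ∀ᵐ x ∂μ, x ∉ X ⁻¹' {a} := measure_eq_zero_iff_ae_notMem.1 ha
      filter_upwards [this] with x hx _ using hx
    · exact Eventually.of_forall fun x h => absurd h ha
  filter_upwards [h] with x hx h0 using hx _ h0 rfl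

lemma ae_info_comp_le [IsFiniteMeasure μ] (X : Ω → α) (φ : α → β) :
    ∀ᵐ x ∂μ, info μ (fun y => φ (X y)) x ≤ info μ X x := by
  filter_upwards [ae_measure_fibre_ne_zero (μ := μ) X] with x hx
  refine neg_le_neg (Real.log_le_log ?_ (measureReal_mono fun y hy => ?_))
  · exact ENNReal.toReal_pos hx (measure_ne_top _ _)
  · simp only [mem_preimage, mem_singleton_iff] at hy ⊢
    rw [hy]

variable [MeasurableSpace α] [DiscreteMeasurableSpace α]

lemma info_comp_measurePreserving {T : Ω → Ω} (hT : MeasurePreserving T μ μ) {X : Ω → α}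
    (hX : Measurable X) (x : Ω) : info μ (fun y => X (T y)) x = info μ X (T x) := by
  unfold info
  congr 2
  exact hT.measureReal_preimage (hX (measurableSet_singleton _)).nullMeasurableSet

lemma entropy_comp_measurePreserving {T : Ω → Ω} (hT : MeasurePreserving T μ μ) {X : Ω → α}
    (hX : Measurable X) : entropy μ (fun y => X (T y)) = entropy μ X := by
  unfold entropy
  simp_rw [info_comp_measurePreserving hT hX]
  exact integral_comp_of_measurePreserving hT (measurable_info hX).aestronglyMeasurable

lemma lintegral_comp_countable {X : Ω → α} (hX : Measurable X) (g : α → ℝ≥0∞) :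
    ∫⁻ x, g (X x) ∂μ = ∑' a, g a * μ (X ⁻¹' {a}) := by
  rw [← lintegral_map Measurable.of_discrete hX, lintegral_countable']
  congr with a
  rw [Measure.map_apply hX (measurableSet_singleton a)]

lemma partitionEntropy_eq_lintegral [IsProbabilityMeasure μ] {X : Ω → α} (hX : Measurable X) :
    partitionEntropy μ X = ∫⁻ x, ENNReal.ofReal (info μ X x) ∂μ := by
  have := lintegral_comp_countable (μ := μ) hX
    fun a => ENNReal.ofReal (-Real.log (μ.real (X ⁻¹' {a})))
  rw [partitionEntropy]
  refine Eq.trans ?_ this.symm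
  congr with a
  have h0 : μ (X ⁻¹' {a}) = ENNReal.ofReal (μ.real (X ⁻¹' {a})) := by simp [measureReal_def]
  conv_rhs => rw [h0]
  rw [← ENNReal.ofReal_mul' measureReal_nonneg, Real.negMulLog, measureReal_def]
  congr 1
  ring

lemma integrable_info [IsProbabilityMeasure μ] {X : Ω → α} (hX : Measurable X)
    (hH : partitionEntropy μ X < ∞) : Integrable (info μ X) μ := by
  rw [partitionEntropy_eq_lintegral hX] at hH
  exact (lintegral_ofReal_ne_top_iff_integrable (measurable_info hX).aestronglyMeasurable
    (Eventually.of_forall fun x => info_nonneg X x)).1 hH.ne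

end Countable

section Finite

variable [Fintype α] [MeasurableSpace α] [DiscreteMeasurableSpace α] [IsProbabilityMeasure μ]

lemma integrable_comp_finite {X : Ω → α} (hX : Measurable X) (g : α → ℝ) :
    Integrable (fun x => g (X x)) μ := by
  have : Integrable g (μ.map X) := by
    have := Measure.isProbabilityMeasure_map (μ := μ) hX.aemeasurable
    exact Integrable.of_finite
  exact this.comp_measurable hX

lemma integral_comp_finite {X : Ω → α} (hX : Measurable X) (g : α → ℝ) :
    ∫ x, g (X x) ∂μ = ∑ a, μ.real (X ⁻¹' {a}) * g a := by
  have := Measure.isProbabilityMeasure_map (μ := μ) hX.aemeasurable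
  rw [← integral_map (f := g) hX.aemeasurable Measurable.of_discrete.aestronglyMeasurable,
    integral_fintype Integrable.of_finite]
  refine Finset.sum_congr rfl fun a _ => ?_
  rw [map_measureReal_apply hX (measurableSet_singleton a), smul_eq_mul]

lemma integrable_info_finite {X : Ω → α} (hX : Measurable X) : Integrable (info μ X) μ :=
  integrable_comp_finite hX fun a => -Real.log (μ.real (X ⁻¹' {a}))

lemma entropy_eq_sum {X : Ω → α} (hX : Measurable X) :
    entropy μ X = ∑ a, Real.negMulLog (μ.real (X ⁻¹' {a})) := by
  refine (integral_comp_finite hX fun a => -Real.log (μ.real (X ⁻¹' {a}))).trans ?_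
  refine Finset.sum_congr rfl fun a _ => ?_
  rw [Real.negMulLog]
  ring

lemma partitionEntropy_eq_ofReal {X : Ω → α} (hX : Measurable X) :
    partitionEntropy μ X = ENNReal.ofReal (entropy μ X) := by
  rw [partitionEntropy_eq_lintegral hX, entropy,
    ofReal_integral_eq_lintegral_ofReal (integrable_info_finite hX)
      (Eventually.of_forall fun x => info_nonneg X x)]

end Finite

/-- Functions with integral at most `1` grow at most quadratically, almost everywhere. -/
lemma ae_eventually_le_sq {φ : ℕ → Ω → ℝ≥0∞} (hφ : ∀ n, Measurable (φ n))
    (h : ∀ n, ∫⁻ x, φ n x ∂μ ≤ 1) :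
    ∀ᵐ x ∂μ, ∀ᶠ n : ℕ in atTop, φ n x ≤ ENNReal.ofReal (((n : ℝ) + 1) ^ 2) := by
  -- Markov's inequality bounds each term by 1/(n+1)², which is summable; Borel–Cantelli then
  -- applies.
  have hs : ∑' n : ℕ, μ {x | ENNReal.ofReal (((n : ℝ) + 1) ^ 2) ≤ φ n x} ≠ ∞ := by
    have hsum : Summable fun n : ℕ => 1 / ((n : ℝ) + 1) ^ 2 := by
      have := (summable_nat_add_iff 1).2 (Real.summable_one_div_nat_pow.2 one_lt_two)
      simpa using this
    refine ne_top_of_le_ne_top hsum.tsum_ofReal_ne_top (ENNReal.tsum_le_tsum fun n => ?_)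
    have hpos : 0 < ((n : ℝ) + 1) ^ 2 := by positivity
    refine (meas_ge_le_lintegral_div (hφ n).aemeasurable (ENNReal.ofReal_pos.2 hpos).ne'
      ENNReal.ofReal_ne_top).trans ?_
    rw [ENNReal.ofReal_div_of_pos hpos, ENNReal.ofReal_one]
    gcongr
    exact h n
  filter_upwards [ae_eventually_notMem hs] with x hx
  filter_upwards [hx] with n hn
  exact (not_le.1 hn).le

end Information

/-! ### Cylinders as fibres of itineraries -/

section Itinerary

variable {Ω ι : Type*} {T : Ω → Ω} {P : Ω → ι}

lemma cylinder_eq_preimage (n : ℕ) (z : Ω) :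
    cylinder T P n z = itinerary T P n ⁻¹' {itinerary T P n z} := by
  ext y
  simp only [cylinder, itinerary, mem_preimage, mem_singleton_iff, funext_iff, Fin.forall_iff]
  rfl

lemma cylinder_anti {m n : ℕ} (h : m ≤ n) (z : Ω) : cylinder T P n z ⊆ cylinder T P m z :=
  fun _ hy i hi => hy i (hi.trans_le h)

lemma itinerary_succ (n : ℕ) (x : Ω) :
    itinerary T P (n + 1) x = Fin.cons (P x) (itinerary T P n (T x)) := by
  funext i
  refine Fin.cases ?_ (fun j => ?_) i <;> simp [itinerary]

lemma measurable_itinerary [MeasurableSpace Ω] [MeasurableSpace ι] (hT : Measurable T)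
    (hP : Measurable P) (n : ℕ) :
    Measurable (itinerary T P n) :=
  measurable_pi_lambda _ fun i => hP.comp (hT.iterate i)

lemma info_itinerary [MeasurableSpace Ω] (μ : Measure Ω) (n : ℕ) (z : Ω) :
    info μ (itinerary T P n) z = -Real.log (μ.real (cylinder T P n z)) := by
  rw [info, cylinder_eq_preimage]

end Itinerary

/-! ### Conditional probabilities and the chain rule for entropy -/

section ConditionalEntropy

variable {Ω α β : Type*} [mΩ : MeasurableSpace Ω] {μ : Measure Ω} [IsProbabilityMeasure μ]

lemma negMulLog_le_one {x : ℝ} (hx : 0 ≤ x) : Real.negMulLog x ≤ 1 := by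
  rcases hx.eq_or_lt with rfl | hx
  · simp
  have h := mul_le_mul_of_nonneg_left (Real.one_sub_inv_le_log_of_pos hx) hx.le
  rw [mul_sub, mul_inv_cancel₀ hx.ne'] at h
  rw [Real.negMulLog]
  linarith

variable [Fintype α] [MeasurableSpace α] [DiscreteMeasurableSpace α]
  [Fintype β] [MeasurableSpace β] [DiscreteMeasurableSpace β]

lemma condExp_indicator_comap_finite {X : Ω → α} {Y : Ω → β} (hX : Measurable X)
    (hY : Measurable Y) (a : α) :
    μ[(X ⁻¹' {a}).indicator (fun _ => (1 : ℝ)) | MeasurableSpace.comap Y inferInstance]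
      =ᵐ[μ] fun x => μ.real ((fun x => (X x, Y x)) ⁻¹' {(a, Y x)}) / μ.real (Y ⁻¹' {Y x}) := by
  classical
  set h : β → ℝ := fun y => μ.real ((fun x => (X x, Y x)) ⁻¹' {(a, y)}) / μ.real (Y ⁻¹' {y})
  have hint : Integrable ((X ⁻¹' {a}).indicator (fun _ => (1 : ℝ))) μ :=
    (integrable_const _).indicator (hX (measurableSet_singleton a))
  refine (ae_eq_condExp_of_forall_setIntegral_eq hY.comap_le hint
    (fun s _ _ => (integrable_comp_finite hY h).integrableOn) ?_ ?_).symm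
  · rintro _ ⟨S, hS, rfl⟩ -
    rw [← integral_indicator (hY hS), ← integral_indicator (hY hS)]
    have h1 : (Y ⁻¹' S).indicator (fun x => h (Y x)) = fun x => (S.indicator h) (Y x) := rfl
    have h2 : (Y ⁻¹' S).indicator ((X ⁻¹' {a}).indicator (fun _ => (1 : ℝ)))
        = fun x => (fun p : α × β => S.indicator (fun _ => if p.1 = a then (1 : ℝ) else 0) p.2)
          (X x, Y x) := by
      funext x
      simp [indicator_apply]
    rw [h1, h2, integral_comp_finite hY, integral_comp_finite (hX.prodMk hY),
      Fintype.sum_prod_type_right]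
    refine Finset.sum_congr rfl fun y _ => ?_
    by_cases hy : y ∈ S
    · simp only [indicator_of_mem hy, mul_ite, mul_one, mul_zero, Finset.sum_ite_eq',
        Finset.mem_univ, if_true, h]
      -- A null fibre of Y makes the numerator vanish too, so the junk value 0/0 = 0 does no harm.
      refine mul_div_cancel_of_imp' fun h0 => ?_
      refine measureReal_mono_null (fun x hx => ?_) h0
      simp only [mem_preimage, mem_singleton_iff, Prod.mk.injEq] at hx ⊢
      exact hx.2
    · simp [indicator_of_notMem hy]
  · refine StronglyMeasurable.aestronglyMeasurable ?_
    exact (StronglyMeasurable.of_discrete (f := h)).comp_measurable (comap_measurable Y)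

/-- The chain rule H(X, Y) = H(Y) + H(X | Y), with H(X | Y) written through conditional expectations
so that martingale convergence can be applied to it. -/
lemma sum_integral_negMulLog_condExp {X : Ω → α} {Y : Ω → β} (hX : Measurable X)
    (hY : Measurable Y) :
    ∑ a, ∫ x, Real.negMulLog ((μ[(X ⁻¹' {a}).indicator (fun _ => (1 : ℝ)) |
        MeasurableSpace.comap Y inferInstance]) x) ∂μ
      = entropy μ (fun x => (X x, Y x)) - entropy μ Y := by
  have hXY := hX.prodMk hY
  have h1 : entropy μ Y = ∑ p : α × β, μ.real ((fun x => (X x, Y x)) ⁻¹' {p}) *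
      (-Real.log (μ.real (Y ⁻¹' {p.2}))) :=
    integral_comp_finite hXY fun p : α × β => -Real.log (μ.real (Y ⁻¹' {p.2}))
  rw [entropy_eq_sum hXY, h1, ← Finset.sum_sub_distrib, Fintype.sum_prod_type]
  refine Finset.sum_congr rfl fun a _ => ?_
  rw [integral_congr_ae (g := fun x => (fun y => Real.negMulLog
    (μ.real ((fun x => (X x, Y x)) ⁻¹' {(a, y)}) / μ.real (Y ⁻¹' {y}))) (Y x))]
  · refine (integral_comp_finite hY fun y => Real.negMulLog
      (μ.real ((fun x => (X x, Y x)) ⁻¹' {(a, y)}) / μ.real (Y ⁻¹' {y}))).trans ?_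
    refine Finset.sum_congr rfl fun y _ => ?_
    have hle : μ.real (Y ⁻¹' {y}) = 0 → μ.real ((fun x => (X x, Y x)) ⁻¹' {(a, y)}) = 0 :=
      measureReal_mono_null fun x hx => by
        simp only [mem_preimage, mem_singleton_iff, Prod.mk.injEq] at hx ⊢
        exact hx.2
    generalize μ.real (Y ⁻¹' {y}) = m at hle ⊢
    generalize μ.real ((fun x => (X x, Y x)) ⁻¹' {(a, y)}) = r at hle ⊢
    by_cases hr : r = 0
    · simp [hr]
    · have hm : m ≠ 0 := fun h => hr (hle h)
      rw [Real.negMulLog, Real.negMulLog, Real.log_div hr hm]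
      field_simp
      ring
  · filter_upwards [condExp_indicator_comap_finite (μ := μ) hX hY a] with x hx
    rw [hx]

lemma ae_condExp_indicator_mem_Icc (m : MeasurableSpace Ω) {B : Set Ω} (hB : MeasurableSet[mΩ] B) :
    ∀ᵐ x ∂μ, (μ[B.indicator (fun _ => (1 : ℝ)) | m]) x ∈ Icc (0 : ℝ) 1 := by
  by_cases hm : m ≤ mΩ
  · have hint : Integrable (B.indicator (fun _ => (1 : ℝ))) μ := (integrable_const _).indicator hB
    have h0 : (0 : Ω → ℝ) ≤ᵐ[μ] μ[B.indicator (fun _ => (1 : ℝ)) | m] :=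
      condExp_nonneg (Eventually.of_forall fun x => indicator_nonneg (by simp) x)
    have h1 : μ[B.indicator (fun _ => (1 : ℝ)) | m] ≤ᵐ[μ] μ[fun _ => (1 : ℝ) | m] :=
      condExp_mono hint (integrable_const _)
        (Eventually.of_forall fun x => indicator_le_self' (by simp) x)
    rw [condExp_const hm] at h1
    filter_upwards [h0, h1] with x hx0 hx1 using ⟨hx0, hx1⟩
  · simp [condExp_of_not_le hm]

/-- The measure with density the conditional probability of B and the restriction of μ to B agree on
`m`, hence integrate `m`-measurable functions alike. -/
lemma lintegral_condLExp_indicator_mul {m : MeasurableSpace Ω} (hm : m ≤ mΩ) {B : Set Ω}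
    (hB : MeasurableSet[mΩ] B) {g : Ω → ℝ≥0∞} (hg : Measurable[m] g) :
    ∫⁻ x, (μ⁻[B.indicator 1 | m]) x * g x ∂μ = ∫⁻ x in B, g x ∂μ := by
  have he : Measurable[mΩ] (μ⁻[B.indicator 1 | m]) := measurable_condLExp' m μ _
  have h : (μ.withDensity (μ⁻[B.indicator 1 | m])).trim hm = (μ.restrict B).trim hm := by
    refine @Measure.ext _ m _ _ fun s hs => ?_
    rw [trim_measurableSet_eq hm hs, trim_measurableSet_eq hm hs, withDensity_apply _ (hm s hs),
      setLIntegral_condLExp hm _ _ hs, lintegral_indicator_one hB, Measure.restrict_apply hB,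
      Measure.restrict_apply (hm s hs), inter_comm]
  have h2 := lintegral_withDensity_eq_lintegral_mul μ he (hg.mono hm le_rfl)
  rw [← lintegral_trim hm hg, ← h, lintegral_trim hm hg, h2]
  rfl

end ConditionalEntropy

/-! ### Predicting a label from the future; the entropy rate -/

section Prediction

variable {Ω α : Type*} [MeasurableSpace α]
  {T : Ω → Ω} {Q : Ω → α}

/-- The `σ`-algebra generated by the labels of the whole forward orbit. -/
@[reducible]
def orbitAlgebra (T : Ω → Ω) (Q : Ω → α) : MeasurableSpace Ω :=
  ⨆ n, MeasurableSpace.comap (itinerary T Q n) inferInstance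

lemma measurable_itinerary_orbitAlgebra (n : ℕ) : Measurable[orbitAlgebra T Q] (itinerary T Q n) :=
  Measurable.mono (comap_measurable _)
    (le_iSup (fun n => MeasurableSpace.comap (itinerary T Q n) inferInstance) n) le_rfl

lemma comap_orbitAlgebra_le_self : (orbitAlgebra T Q).comap T ≤ orbitAlgebra T Q := by
  rw [orbitAlgebra, MeasurableSpace.comap_iSup]
  refine iSup_le fun n => ?_
  rw [MeasurableSpace.comap_comp]
  have : itinerary T Q n ∘ T
      = (fun (w : Fin (n + 1) → α) (i : Fin n) => w i.succ) ∘ itinerary T Q (n + 1) := rfl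
  rw [this, ← MeasurableSpace.comap_comp]
  refine le_iSup_of_le (n + 1) (MeasurableSpace.comap_mono
    (Measurable.comap_le (measurable_pi_lambda _ fun i => measurable_pi_apply _)))

lemma measurable_orbitAlgebra_map :
    @Measurable _ _ (orbitAlgebra T Q) (orbitAlgebra T Q) T :=
  measurable_iff_comap_le.2 comap_orbitAlgebra_le_self

lemma measurable_label_orbitAlgebra : Measurable[orbitAlgebra T Q] Q :=
  (measurable_pi_apply (0 : Fin 1)).comp (measurable_itinerary_orbitAlgebra 1)

lemma measurable_apply_label [MeasurableSpace Ω] [Finite α] [DiscreteMeasurableSpace α]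
    (hQ : Measurable Q) {g : α → Ω → ℝ≥0∞} (hg : ∀ a, Measurable (g a)) :
    Measurable fun x => g (Q x) x :=
  (measurable_from_prod_countable_right (f := fun p : α × Ω => g p.1 p.2) hg).comp
    (hQ.prodMk measurable_id)

variable [mΩ : MeasurableSpace Ω] {μ : Measure Ω}

/-- The filtration generated by the labels of `T x, …, Tⁿ x`. -/
def futureFiltration (hT : Measurable T) (hQ : Measurable Q) : Filtration ℕ mΩ where
  seq n := MeasurableSpace.comap (fun x => itinerary T Q n (T x)) inferInstance
  mono' m n hmn := by
    have : (fun x => itinerary T Q m (T x))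
        = (fun (w : Fin n → α) (i : Fin m) => w (Fin.castLE hmn i)) ∘
          fun x => itinerary T Q n (T x) := rfl
    simp only
    rw [this, ← MeasurableSpace.comap_comp]
    exact MeasurableSpace.comap_mono
      (Measurable.comap_le (measurable_pi_lambda _ fun i => measurable_pi_apply _))
  le' n := ((measurable_itinerary hT hQ n).comp hT).comap_le

lemma iSup_futureFiltration (hT : Measurable T) (hQ : Measurable Q) :
    ⨆ n, futureFiltration hT hQ n = (orbitAlgebra T Q).comap T := by
  rw [orbitAlgebra, MeasurableSpace.comap_iSup]
  refine iSup_congr fun n => ?_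
  rw [MeasurableSpace.comap_comp]
  rfl

lemma orbitAlgebra_le (hT : Measurable T) (hQ : Measurable Q) : orbitAlgebra T Q ≤ mΩ :=
  iSup_le fun n => (measurable_itinerary hT hQ n).comap_le

lemma comap_orbitAlgebra_le (hT : Measurable T) (hQ : Measurable Q) :
    (orbitAlgebra T Q).comap T ≤ mΩ :=
  comap_orbitAlgebra_le_self.trans (orbitAlgebra_le hT hQ)

/-- The conditional probability of the label `a` given the labels of `T x, T² x, …`. -/
def futureProb (μ : Measure Ω) (T : Ω → Ω) (Q : Ω → α) (a : α) : Ω → ℝ≥0∞ :=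
  μ⁻[(Q ⁻¹' {a}).indicator 1 | (orbitAlgebra T Q).comap T]

/-- The conditional probability of the actual label of `x` given the labels of `T x, T² x, …`. -/
def predProb (μ : Measure Ω) (T : Ω → Ω) (Q : Ω → α) (x : Ω) : ℝ≥0∞ := futureProb μ T Q (Q x) x

lemma measurable_futureProb (a : α) :
    Measurable[(orbitAlgebra T Q).comap T] (futureProb μ T Q a) :=
  measurable_condLExp _ _ _

variable [Fintype α]

lemma ae_futureProb_le_one [IsProbabilityMeasure μ] (hT : Measurable T) (hQ : Measurable Q) :
    ∀ᵐ x ∂μ, ∀ a, futureProb μ T Q a x ≤ 1 := by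
  rw [ae_all_iff]
  intro a
  have h : futureProb μ T Q a ≤ᵐ[μ] μ⁻[1 | (orbitAlgebra T Q).comap T] :=
    condLExp_mono (Eventually.of_forall fun x => indicator_le_self' (by simp) x)
  rw [condLExp_one (comap_orbitAlgebra_le hT hQ)] at h
  exact h

variable [DiscreteMeasurableSpace α]

lemma measurable_predProb : Measurable[orbitAlgebra T Q] (predProb μ T Q) :=
  @measurable_apply_label _ _ _ _ (orbitAlgebra T Q) _ _ measurable_label_orbitAlgebra _
    fun a => (measurable_futureProb a).mono comap_orbitAlgebra_le_self le_rfl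

/-- An integral over `Ω` is split according to the label. -/
lemma lintegral_eq_sum_setLIntegral (hQ : Measurable Q) (g : α → Ω → ℝ≥0∞) :
    ∫⁻ x, g (Q x) x ∂μ = ∑ a, ∫⁻ x in Q ⁻¹' {a}, g a x ∂μ := by
  have h := lintegral_iUnion (μ := μ) (fun a => hQ (measurableSet_singleton a))
    (fun a b hab => disjoint_left.2 fun x (hx : Q x = a) (hx' : Q x = b) => hab (hx.symm.trans hx'))
    (fun x => g (Q x) x)
  have hu : ⋃ a, Q ⁻¹' {a} = univ := by ext; simp
  rw [hu, setLIntegral_univ, tsum_fintype] at h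
  rw [h]
  refine Finset.sum_congr rfl fun a _ => setLIntegral_congr_fun (hQ (measurableSet_singleton a)) ?_
  intro x hx
  have hx' : Q x = a := hx
  simp only [hx']

lemma measurable_log_predProb (hT : Measurable T) (hQ : Measurable Q) :
    Measurable fun x => -Real.log (predProb μ T Q x).toReal :=
  (measurable_predProb.mono (orbitAlgebra_le hT hQ) le_rfl).ennreal_toReal.log.neg

variable [IsProbabilityMeasure μ]

/-- Induction on the length, splitting by the first label a. The other factors depend on T x only
through its labels, so conditioning on the future replaces the indicator of {Q = a} by its
conditional probability, which cancels the first inverse. Invariance removes T and leaves the case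
of the weights c(a, ·). -/
lemma lintegral_mul_prod_predProb_inv_le (hT : MeasurePreserving T μ μ) (hQ : Measurable Q) (n : ℕ)
    (c : (Fin n → α) → ℝ≥0∞) :
    ∫⁻ x, c (itinerary T Q n x) * ∏ i ∈ Finset.range n, (predProb μ T Q (T^[i] x))⁻¹ ∂μ
      ≤ ∑ w, c w := by
  induction n with
  | zero =>
    simp [Subsingleton.elim (itinerary T Q 0 _) default]
  | succ n ih =>
    set g : α → Ω → ℝ≥0∞ := fun a y => c (Fin.cons a (itinerary T Q n y)) *
      ∏ i ∈ Finset.range n, (predProb μ T Q (T^[i] y))⁻¹ with hg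
    -- Measurability for the orbit algebra, not just for the ambient one, is what lets g a ∘ T be
    -- pulled out of the conditional expectation.
    have hgm : ∀ a, Measurable[orbitAlgebra T Q] (g a) := by
      intro a
      refine Measurable.mul ?_ ?_
      · exact (Measurable.of_discrete (f := fun w : Fin n → α => c (Fin.cons a w))).comp
          (measurable_itinerary_orbitAlgebra n)
      · refine Finset.measurable_prod _ fun i _ => Measurable.inv ?_
        exact measurable_predProb.comp
          (@Measurable.iterate _ (orbitAlgebra T Q) T measurable_orbitAlgebra_map i)
    have hsplit : ∀ x, c (itinerary T Q (n + 1) x) *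
        ∏ i ∈ Finset.range (n + 1), (predProb μ T Q (T^[i] x))⁻¹
        = (fun a x => g a (T x) * (futureProb μ T Q a x)⁻¹) (Q x) x := by
      intro x
      simp only [hg, itinerary_succ, Finset.prod_range_succ', Function.iterate_succ_apply,
        Function.iterate_zero_apply, predProb, mul_assoc]
    simp_rw [hsplit]
    rw [lintegral_eq_sum_setLIntegral hQ (fun a x => g a (T x) * (futureProb μ T Q a x)⁻¹)]
    have hsum : ∑ w, c w = ∑ a, ∑ w, c (Fin.cons a w) := by
      rw [← Fintype.sum_prod_type', ← (Fin.consEquiv fun _ => α).sum_comp]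
      rfl
    rw [hsum]
    refine Finset.sum_le_sum fun a _ => le_trans ?_ (ih fun w => c (Fin.cons a w))
    have hgT : Measurable[(orbitAlgebra T Q).comap T] fun x => g a (T x) :=
      (hgm a).comp (comap_measurable T)
    have hga : Measurable (g a) := (hgm a).mono (orbitAlgebra_le hT.measurable hQ) le_rfl
    rw [← lintegral_condLExp_indicator_mul (comap_orbitAlgebra_le hT.measurable hQ)
      (hQ (measurableSet_singleton a)) (g := fun x => g a (T x) * (futureProb μ T Q a x)⁻¹)
      (hgT.mul (measurable_futureProb a).inv)]
    refine le_trans (lintegral_mono (g := fun x => g a (T x)) fun x => ?_)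
      (hT.lintegral_comp hga).le
    change futureProb μ T Q a x * (g a (T x) * (futureProb μ T Q a x)⁻¹) ≤ g a (T x)
    -- Only an inequality holds: p · p⁻¹ is 0 where p = 0 or p = ∞.
    rw [mul_left_comm]
    exact mul_le_of_le_one_right zero_le (ENNReal.mul_inv_le_one _)

/-- The integrated surprise of the label given the labels of the future orbit. -/
def predEntropy (μ : Measure Ω) (T : Ω → Ω) (Q : Ω → α) : ℝ :=
  ∫ x, -Real.log (predProb μ T Q x).toReal ∂μ

/-- Conditioning on the future turns the indicator of {Q = a} into its conditional probability p,
and -log p into -p log p, which is bounded. -/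
lemma lintegral_neg_log_predProb (hT : Measurable T) (hQ : Measurable Q) :
    ∫⁻ x, ENNReal.ofReal (-Real.log (predProb μ T Q x).toReal) ∂μ
      = ∑ a, ∫⁻ x, ENNReal.ofReal (Real.negMulLog (futureProb μ T Q a x).toReal) ∂μ := by
  refine (lintegral_eq_sum_setLIntegral hQ
    fun a x => ENNReal.ofReal (-Real.log (futureProb μ T Q a x).toReal)).trans ?_
  refine Finset.sum_congr rfl fun a _ => ?_
  rw [← lintegral_condLExp_indicator_mul (comap_orbitAlgebra_le hT hQ)
      (hQ (measurableSet_singleton a))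
      (g := fun x => ENNReal.ofReal (-Real.log (futureProb μ T Q a x).toReal))
      (measurable_futureProb a).ennreal_toReal.log.neg.ennreal_ofReal]
  refine lintegral_congr_ae ?_
  filter_upwards [ae_futureProb_le_one (μ := μ) hT hQ] with x hx
  have hne : futureProb μ T Q a x ≠ ∞ := ne_top_of_le_ne_top ENNReal.one_ne_top (hx a)
  change futureProb μ T Q a x * _ = _
  conv_lhs => rw [← ENNReal.ofReal_toReal hne]
  rw [← ENNReal.ofReal_mul ENNReal.toReal_nonneg, ENNReal.toReal_ofReal ENNReal.toReal_nonneg,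
    Real.negMulLog]
  congr 1
  ring

lemma toReal_mem_Icc_of_le_one {a : ℝ≥0∞} (h : a ≤ 1) : a.toReal ∈ Icc (0 : ℝ) 1 :=
  ⟨ENNReal.toReal_nonneg, ENNReal.toReal_mono ENNReal.one_ne_top h⟩

lemma integrable_negMulLog_futureProb (hT : Measurable T) (hQ : Measurable Q) (a : α) :
    Integrable (fun x => Real.negMulLog (futureProb μ T Q a x).toReal) μ := by
  refine Integrable.of_bound (C := 1) ?_ ?_
  · exact (Real.continuous_negMulLog.measurable.comp ((measurable_futureProb a).mono
      (comap_orbitAlgebra_le hT hQ) le_rfl).ennreal_toReal).aestronglyMeasurable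
  · filter_upwards [ae_futureProb_le_one (μ := μ) hT hQ] with x hx
    have h := toReal_mem_Icc_of_le_one (hx a)
    rw [Real.norm_of_nonneg (Real.negMulLog_nonneg h.1 h.2)]
    exact negMulLog_le_one h.1

lemma ae_neg_log_predProb_nonneg (hT : Measurable T) (hQ : Measurable Q) :
    ∀ᵐ x ∂μ, 0 ≤ -Real.log (predProb μ T Q x).toReal := by
  filter_upwards [ae_futureProb_le_one (μ := μ) hT hQ] with x hx
  have h := toReal_mem_Icc_of_le_one (hx (Q x))
  exact neg_nonneg.2 (Real.log_nonpos h.1 h.2)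

lemma ae_negMulLog_futureProb_nonneg (hT : Measurable T) (hQ : Measurable Q) (a : α) :
    0 ≤ᵐ[μ] fun x => Real.negMulLog (futureProb μ T Q a x).toReal := by
  filter_upwards [ae_futureProb_le_one (μ := μ) hT hQ] with x hx
  have h := toReal_mem_Icc_of_le_one (hx a)
  exact Real.negMulLog_nonneg h.1 h.2

lemma lintegral_neg_log_predProb_eq_ofReal (hT : Measurable T) (hQ : Measurable Q) :
    ∫⁻ x, ENNReal.ofReal (-Real.log (predProb μ T Q x).toReal) ∂μ
      = ENNReal.ofReal (∑ a, ∫ x, Real.negMulLog (futureProb μ T Q a x).toReal ∂μ) := by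
  rw [lintegral_neg_log_predProb hT hQ, ENNReal.ofReal_sum_of_nonneg fun a _ =>
    integral_nonneg_of_ae (ae_negMulLog_futureProb_nonneg hT hQ a)]
  refine Finset.sum_congr rfl fun a _ => ?_
  rw [ofReal_integral_eq_lintegral_ofReal (integrable_negMulLog_futureProb hT hQ a)
    (ae_negMulLog_futureProb_nonneg hT hQ a)]

lemma integrable_neg_log_predProb (hT : Measurable T) (hQ : Measurable Q) :
    Integrable (fun x => -Real.log (predProb μ T Q x).toReal) μ := by
  refine (lintegral_ofReal_ne_top_iff_integrable
    (measurable_log_predProb hT hQ).aestronglyMeasurable (ae_neg_log_predProb_nonneg hT hQ)).1 ?_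
  rw [lintegral_neg_log_predProb_eq_ofReal hT hQ]
  exact ENNReal.ofReal_ne_top

lemma predEntropy_eq_sum (hT : Measurable T) (hQ : Measurable Q) :
    predEntropy μ T Q = ∑ a, ∫ x, Real.negMulLog (futureProb μ T Q a x).toReal ∂μ := by
  rw [predEntropy, integral_eq_lintegral_of_nonneg_ae (ae_neg_log_predProb_nonneg hT hQ)
    (measurable_log_predProb hT hQ).aestronglyMeasurable,
    lintegral_neg_log_predProb_eq_ofReal hT hQ, ENNReal.toReal_ofReal]
  exact Finset.sum_nonneg fun a _ => integral_nonneg_of_ae (ae_negMulLog_futureProb_nonneg hT hQ a)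

lemma entropy_itinerary_succ_eq (n : ℕ) :
    entropy μ (itinerary T Q (n + 1)) = entropy μ (fun x => (Q x, itinerary T Q n (T x))) := by
  have := info_comp_injective (μ := μ) (fun x => (Q x, itinerary T Q n (T x)))
    (Fin.consEquiv fun _ => α).injective
  unfold entropy
  rw [← this]
  refine integral_congr_ae (Eventually.of_forall fun x => ?_)
  congr 1
  funext x
  exact itinerary_succ n x

/-- By the chain rule the increment is the entropy of Q given the next n labels. Lévy's upward
theorem and continuity of -t log t, with values in [0, 1], give the limit. -/
theorem tendsto_entropy_itinerary_succ_sub (hT : MeasurePreserving T μ μ) (hQ : Measurable Q) :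
    Tendsto (fun n => entropy μ (itinerary T Q (n + 1)) - entropy μ (itinerary T Q n)) atTop
      (𝓝 (predEntropy μ T Q)) := by
  have hTm := hT.measurable
  set I : α → Ω → ℝ := fun a => (Q ⁻¹' {a}).indicator (fun _ => (1 : ℝ))
  have key : ∀ n, entropy μ (itinerary T Q (n + 1)) - entropy μ (itinerary T Q n)
      = ∑ a, ∫ x, Real.negMulLog ((μ[I a | futureFiltration hTm hQ n]) x) ∂μ := by
    intro n
    have hi := measurable_itinerary hTm hQ n
    rw [entropy_itinerary_succ_eq, ← entropy_comp_measurePreserving hT hi,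
      ← sum_integral_negMulLog_condExp hQ (Y := fun x => itinerary T Q n (T x)) (hi.comp hTm)]
    rfl
  simp_rw [key]
  rw [predEntropy_eq_sum hTm hQ]
  refine tendsto_finsetSum _ fun a _ => ?_
  have hIa : MeasurableSet (Q ⁻¹' {a}) := hQ (measurableSet_singleton a)
  refine tendsto_integral_of_dominated_convergence (fun _ => (1 : ℝ)) ?_ (integrable_const _) ?_ ?_
  · intro n
    exact (Real.continuous_negMulLog.comp_stronglyMeasurable
      (stronglyMeasurable_condExp.mono ((futureFiltration hTm hQ).le n))).aestronglyMeasurable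
  · intro n
    filter_upwards [ae_condExp_indicator_mem_Icc (μ := μ) (futureFiltration hTm hQ n) hIa] with x hx
    rw [Real.norm_of_nonneg (Real.negMulLog_nonneg hx.1 hx.2)]
    exact negMulLog_le_one hx.1
  · have h1 := tendsto_ae_condExp (μ := μ) (ℱ := futureFiltration hTm hQ) (I a)
    have h2 : (fun x => (futureProb μ T Q a x).toReal)
        =ᵐ[μ] μ[I a | (orbitAlgebra T Q).comap T] := by
      refine (toReal_condLExp _ (measurable_one.indicator hIa).aemeasurable ?_).trans ?_
      · rw [lintegral_indicator_one hIa]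
        exact measure_ne_top _ _
      · refine condExp_congr_ae (Eventually.of_forall fun x => ?_)
        by_cases hx : x ∈ Q ⁻¹' {a} <;> simp [I, hx]
    rw [iSup_futureFiltration] at h1
    filter_upwards [h1, h2] with x hx1 hx2
    rw [hx2]
    exact (Real.continuous_negMulLog.tendsto _).comp hx1

/-- The entropies telescope, so H(𝒜ⁿ)/n is a Cesàro mean of increments up to a vanishing term. -/
theorem entropyRate_eq_ofReal_predEntropy (hT : MeasurePreserving T μ μ) (hQ : Measurable Q) :
    entropyRate μ T Q = ENNReal.ofReal (predEntropy μ T Q) := by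
  have h := (tendsto_entropy_itinerary_succ_sub hT hQ).cesaro
  have h0 : Tendsto (fun n : ℕ => (n : ℝ)⁻¹ * entropy μ (itinerary T Q 0)) atTop (𝓝 0) := by
    simpa using tendsto_inv_atTop_nhds_zero_nat.mul_const (entropy μ (itinerary T Q 0))
  have h1 := (h.add h0).congr fun n => by
    rw [Finset.sum_range_sub (fun n => entropy μ (itinerary T Q n)), ← mul_add, sub_add_cancel]
  rw [add_zero] at h1
  refine Tendsto.limsup_eq ((ENNReal.tendsto_ofReal h1).congr' ?_)
  filter_upwards [eventually_gt_atTop 0] with n hn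
  rw [partitionEntropy_eq_ofReal (measurable_itinerary hT.measurable hQ n),
    ENNReal.ofReal_mul (by positivity), mul_comm, div_eq_mul_inv,
    ENNReal.ofReal_inv_of_pos (by exact_mod_cast hn), ENNReal.ofReal_natCast]

end Prediction

/-! ### Shannon–McMillan–Breiman for finite partitions: lower half -/

section LowerBound

variable {Ω α : Type*} [MeasurableSpace Ω] {μ : Measure Ω} [IsProbabilityMeasure μ]
  [MeasurableSpace α] {T : Ω → Ω} {Q : Ω → α}

lemma eventually_log_sq_le {δ : ℝ} (hδ : 0 < δ) :
    ∀ᶠ n : ℕ in atTop, Real.log (((n : ℝ) + 1) ^ 2) ≤ n * δ := by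
  have h := (Real.isLittleO_log_id_atTop.def (c := δ / 4) (by positivity))
  have h1 : Tendsto (fun n : ℕ => (n : ℝ) + 1) atTop atTop :=
    tendsto_atTop_add_const_right _ _ tendsto_natCast_atTop_atTop
  filter_upwards [h1.eventually h, eventually_ge_atTop 1] with n hn h1n
  have h1n' : (1 : ℝ) ≤ n := by exact_mod_cast h1n
  rw [Real.norm_eq_abs, Real.norm_eq_abs, id, abs_of_nonneg (by positivity : (0 : ℝ) ≤ n + 1)] at hn
  rw [Real.log_pow]
  push_cast
  nlinarith [le_abs_self (Real.log ((n : ℝ) + 1))]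

variable [Fintype α] [DiscreteMeasurableSpace α]

/-- The integral bound with n = 1 and c = 1 makes the inverse integrable, hence almost everywhere
finite. -/
lemma ae_predProb_ne_zero (hT : MeasurePreserving T μ μ) (hQ : Measurable Q) :
    ∀ᵐ x ∂μ, predProb μ T Q x ≠ 0 := by
  have h := lintegral_mul_prod_predProb_inv_le hT hQ 1 fun _ => 1
  have hm : Measurable (predProb μ T Q) :=
    measurable_predProb.mono (orbitAlgebra_le hT.measurable hQ) le_rfl
  simp only [Finset.range_one, Finset.prod_singleton, Function.iterate_zero, id, one_mul,
    Finset.sum_const, nsmul_eq_mul, mul_one] at h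
  filter_upwards [ae_lt_top hm.inv (ne_top_of_le_ne_top (ENNReal.natCast_ne_top _) h)] with x hx
  exact ENNReal.inv_ne_top.1 hx.ne

/-- The lower half of the Shannon-McMillan-Breiman theorem for finite partitions. -/
theorem ae_eventually_le_info_itinerary (hT : Ergodic T μ) (hQ : Measurable Q) {c : ℝ}
    (hc : c < predEntropy μ T Q) :
    ∀ᵐ x ∂μ, ∀ᶠ n : ℕ in atTop, n * c ≤ info μ (itinerary T Q n) x := by
  obtain ⟨d, hcd, hd⟩ := exists_between hc
  have hTm := hT.measurable
  have hpm : Measurable (predProb μ T Q) :=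
    measurable_predProb.mono (orbitAlgebra_le hTm hQ) le_rfl
  have hit := measurable_itinerary hTm hQ
  have hmarkov := ae_eventually_le_sq (μ := μ)
    (φ := fun n x => μ (itinerary T Q n ⁻¹' {itinerary T Q n x}) *
      ∏ i ∈ Finset.range n, (predProb μ T Q (T^[i] x))⁻¹)
    (fun n => Measurable.mul
      ((Measurable.of_discrete (f := fun w => μ (itinerary T Q n ⁻¹' {w}))).comp (hit n))
      (Finset.measurable_prod _ fun i _ => (hpm.comp (hTm.iterate i)).inv))
    (fun n => (lintegral_mul_prod_predProb_inv_le hT.toMeasurePreserving hQ n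
      fun w => μ (itinerary T Q n ⁻¹' {w})).trans (by
        have := lintegral_comp_countable (μ := μ) (hit n) fun _ => 1
        simp only [lintegral_const, measure_univ, mul_one, one_mul, tsum_fintype] at this
        exact this.ge))
  have hne : ∀ᵐ x ∂μ, ∀ i, predProb μ T Q (T^[i] x) ≠ 0 := ae_all_iff.2 fun i =>
    (hT.quasiMeasurePreserving.iterate i).ae (ae_predProb_ne_zero hT.toMeasurePreserving hQ)
  have hle : ∀ᵐ x ∂μ, ∀ i, predProb μ T Q (T^[i] x) ≤ 1 := ae_all_iff.2 fun i =>
    (hT.quasiMeasurePreserving.iterate i).ae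
      ((ae_futureProb_le_one (μ := μ) hTm hQ).mono fun x hx => hx (Q x))
  have hfib : ∀ᵐ x ∂μ, ∀ n, μ (itinerary T Q n ⁻¹' {itinerary T Q n x}) ≠ 0 :=
    ae_all_iff.2 fun n => ae_measure_fibre_ne_zero _
  filter_upwards [hmarkov, hne, hle, hfib, ae_tendsto_birkhoffSum_div hT
    (measurable_log_predProb hTm hQ) (integrable_neg_log_predProb hTm hQ)]
    with x hx hxne hxle hxfib hxb
  filter_upwards [hx, hxb.eventually_const_lt hd, eventually_log_sq_le (sub_pos.2 hcd),
    eventually_gt_atTop 0] with n hn hb hlog hn0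
  have hn0' : (0 : ℝ) < n := by exact_mod_cast hn0
  rw [lt_div_iff₀ hn0'] at hb
  have hp : ∀ i, 0 < (predProb μ T Q (T^[i] x)).toReal := fun i =>
    ENNReal.toReal_pos (hxne i) (ne_top_of_le_ne_top ENNReal.one_ne_top (hxle i))
  have hm : 0 < μ.real (itinerary T Q n ⁻¹' {itinerary T Q n x}) :=
    ENNReal.toReal_pos (hxfib n) (measure_ne_top _ _)
  have h1 := ENNReal.toReal_mono ENNReal.ofReal_ne_top hn
  rw [ENNReal.toReal_ofReal (by positivity), ENNReal.toReal_mul, ENNReal.toReal_prod] at h1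
  simp only [ENNReal.toReal_inv] at h1
  have h2 := Real.log_le_log (mul_pos hm (Finset.prod_pos fun i _ => inv_pos.2 (hp i))) h1
  rw [Real.log_mul hm.ne' (Finset.prod_pos fun i _ => inv_pos.2 (hp i)).ne',
    Real.log_prod fun i _ => (inv_pos.2 (hp i)).ne'] at h2
  simp only [Real.log_inv] at h2
  change _ < ∑ i ∈ Finset.range n, -Real.log (predProb μ T Q (T^[i] x)).toReal at hb
  rw [info]
  linarith

end LowerBound

/-! ### Shannon–McMillan–Breiman for countable partitions: upper half -/

section UpperBound

variable {Ω ι α : Type*} {T : Ω → Ω} {P : Ω → ι}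

/-- The weight of a word built from the right by conditional weights `r`. -/
def chainWeight (r : ∀ m, ι → (Fin m → ι) → ℝ≥0∞) : ∀ n, (Fin n → ι) → ℝ≥0∞
  | 0, _ => 1
  | n + 1, u => r n (u 0) (Fin.tail u) * chainWeight r n (Fin.tail u)

lemma tsum_chainWeight_le_one {r : ∀ m, ι → (Fin m → ι) → ℝ≥0∞}
    (hr : ∀ m v, ∑' a, r m a v ≤ 1) (n : ℕ) : ∑' u, chainWeight r n u ≤ 1 := by
  induction n with
  | zero => simp [chainWeight]
  | succ n ih =>
    rw [← (Fin.consEquiv fun _ => ι).tsum_eq, ENNReal.tsum_prod', ENNReal.tsum_comm]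
    refine le_trans (ENNReal.tsum_le_tsum fun v => ?_) ih
    have : ∀ a, chainWeight r (n + 1) (Fin.consEquiv (fun _ => ι) (a, v))
        = r n a v * chainWeight r n v := fun a => by
      simp [Fin.consEquiv, chainWeight]
    simp_rw [this]
    rw [ENNReal.tsum_mul_right]
    exact mul_le_of_le_one_left zero_le (hr n v)

lemma chainWeight_itinerary_succ (r : ∀ m, ι → (Fin m → ι) → ℝ≥0∞) (n : ℕ) (x : Ω) :
    chainWeight r (n + 1) (itinerary T P (n + 1) x)
      = r n (P x) (itinerary T P n (T x)) * chainWeight r n (itinerary T P n (T x)) := by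
  rw [itinerary_succ, chainWeight, Fin.cons_zero, Fin.tail_cons]

lemma tsum_measure_preimage_inter [MeasurableSpace Ω] {μ : Measure Ω} [Countable ι]
    [MeasurableSpace ι] [DiscreteMeasurableSpace ι] {X : Ω → ι} (hX : Measurable X) (S : Set Ω) :
    ∑' b, μ (X ⁻¹' {b} ∩ S) = μ S := by
  have := lintegral_comp_countable (μ := μ.restrict S) hX fun _ => 1
  simp only [lintegral_const, Measure.restrict_apply_univ, one_mul] at this
  rw [this]
  congr with b
  rw [Measure.restrict_apply (hX (measurableSet_singleton b))]

variable [MeasurableSpace Ω] {μ : Measure Ω} [IsProbabilityMeasure μ]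

/-- The conditional weights of the Markov approximation of order `k` of `φ ∘ P`, refined to `P`. -/
def markovWeight (μ : Measure Ω) (T : Ω → Ω) (P : Ω → ι) (φ : ι → α) (k m : ℕ) (a : ι)
    (v : Fin m → ι) : ℝ≥0∞ :=
  if h : k ≤ m then
    μ (itinerary T (fun x => φ (P x)) (k + 1) ⁻¹' {Fin.cons (φ a) fun i => φ (v (Fin.castLE h i))})
      / μ (itinerary T (fun x => φ (P x)) k ⁻¹' {fun i => φ (v (Fin.castLE h i))})
      * (μ (P ⁻¹' {a}) / μ ((fun x => φ (P x)) ⁻¹' {φ a}))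
  else μ (P ⁻¹' {a})

/-- The surprise of a step of the Markov approximation. -/
def markovInfo (μ : Measure Ω) (T : Ω → Ω) (P : Ω → ι) (φ : ι → α) (k : ℕ) (x : Ω) : ℝ :=
  info μ (itinerary T (fun y => φ (P y)) (k + 1)) x
    - info μ (itinerary T (fun y => φ (P y)) k) (T x)
    + (info μ P x - info μ (fun y => φ (P y)) x)

lemma exp_neg_info {β : Type*} {X : Ω → β} {x : Ω} (h : μ (X ⁻¹' {X x}) ≠ 0) :
    Real.exp (-info μ X x) = (μ (X ⁻¹' {X x})).toReal := by
  rw [info, neg_neg, measureReal_def, Real.exp_log (ENNReal.toReal_pos h (measure_ne_top _ _))]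

lemma toReal_markovWeight_of_lt (φ : ι → α) {k m : ℕ} (h : m < k) {x : Ω}
    (hx : μ (P ⁻¹' {P x}) ≠ 0) (v : Fin m → ι) :
    (markovWeight μ T P φ k m (P x) v).toReal = Real.exp (-info μ P x) := by
  rw [markovWeight, dif_neg (not_le.2 h), exp_neg_info hx]

lemma toReal_markovWeight_of_le (φ : ι → α) {k m : ℕ} (h : k ≤ m) {x : Ω}
    (hx : μ (P ⁻¹' {P x}) ≠ 0)
    (hx1 : μ ((fun y => φ (P y)) ⁻¹' {φ (P x)}) ≠ 0)
    (hx2 : ∀ n, μ (itinerary T (fun y => φ (P y)) n ⁻¹' {itinerary T (fun y => φ (P y)) n x}) ≠ 0)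
    (hx3 : ∀ n, μ (itinerary T (fun y => φ (P y)) n ⁻¹'
      {itinerary T (fun y => φ (P y)) n (T x)}) ≠ 0) :
    (markovWeight μ T P φ k m (P x) (itinerary T P m (T x))).toReal
      = Real.exp (-markovInfo μ T P φ k x) := by
  have h0 : (fun i : Fin k => φ (itinerary T P m (T x) (Fin.castLE h i)))
      = itinerary T (fun y => φ (P y)) k (T x) := rfl
  rw [markovWeight, dif_pos h, h0]
  have h1 := itinerary_succ (T := T) (P := fun y => φ (P y)) k x
  rw [← h1]
  simp only [ENNReal.toReal_mul, ENNReal.toReal_div]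
  rw [← exp_neg_info (hx2 _), ← exp_neg_info (hx3 _), ← exp_neg_info hx,
    ← exp_neg_info (X := fun y => φ (P y)) hx1, ← Real.exp_sub, ← Real.exp_sub, ← Real.exp_add,
    markovInfo]
  congr 1
  ring

variable [Countable ι] [MeasurableSpace ι] [DiscreteMeasurableSpace ι]
  [Fintype α] [MeasurableSpace α] [DiscreteMeasurableSpace α]

/-- Sub-probability weights on words are eventually dominated by the measure of the words, up to
a quadratic factor. -/
lemma ae_eventually_info_le_of_weight (hT : Measurable T) (hP : Measurable P)
    {w : ∀ n, (Fin n → ι) → ℝ≥0∞} (hw : ∀ n, ∑' u, w n u ≤ 1) :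
    ∀ᵐ x ∂μ, ∀ᶠ n : ℕ in atTop, 0 < (w n (itinerary T P n x)).toReal →
      info μ (itinerary T P n) x
        ≤ -Real.log (w n (itinerary T P n x)).toReal + Real.log (((n : ℝ) + 1) ^ 2) := by
  have hit := measurable_itinerary hT hP
  have hmarkov := ae_eventually_le_sq (μ := μ)
    (φ := fun n x => (fun u => w n u / μ (itinerary T P n ⁻¹' {u})) (itinerary T P n x))
    (fun n => (Measurable.of_discrete
      (f := fun u => w n u / μ (itinerary T P n ⁻¹' {u}))).comp (hit n))
    (fun n => by
      rw [lintegral_comp_countable (hit n) fun u => w n u / μ (itinerary T P n ⁻¹' {u})]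
      exact le_trans (ENNReal.tsum_le_tsum fun u =>
        (mul_comm _ _).trans_le ENNReal.mul_div_le) (hw n))
  have hfib : ∀ᵐ x ∂μ, ∀ n, μ (itinerary T P n ⁻¹' {itinerary T P n x}) ≠ 0 :=
    ae_all_iff.2 fun n => ae_measure_fibre_ne_zero _
  filter_upwards [hmarkov, hfib] with x hx hxfib
  filter_upwards [hx] with n hn hpos
  have hm : 0 < μ.real (itinerary T P n ⁻¹' {itinerary T P n x}) :=
    ENNReal.toReal_pos (hxfib n) (measure_ne_top _ _)
  have h1 := ENNReal.toReal_mono ENNReal.ofReal_ne_top hn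
  rw [ENNReal.toReal_ofReal (by positivity), ENNReal.toReal_div, ← measureReal_def,
    div_le_iff₀ hm] at h1
  have h2 := Real.log_le_log hpos h1
  rw [Real.log_mul (by positivity) hm.ne'] at h2
  rw [info]
  linarith

/-- The weight f b is shared among the labels a over b in proportion to μ(P = a); null fibres can
only lose weight. -/
lemma tsum_comp_mul_div_le {φ : ι → α} (hP : Measurable P) (f : α → ℝ≥0∞) :
    ∑' a, f (φ a) * (μ (P ⁻¹' {a}) / μ ((fun x => φ (P x)) ⁻¹' {φ a})) ≤ ∑ b, f b := by
  have hQ : Measurable fun x => φ (P x) := Measurable.of_discrete.comp hP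
  have h1 := lintegral_comp_countable (μ := μ) hP
    fun a => f (φ a) / μ ((fun x => φ (P x)) ⁻¹' {φ a})
  have h2 := lintegral_comp_countable (μ := μ) hQ fun b => f b / μ ((fun x => φ (P x)) ⁻¹' {b})
  have h3 : ∑' a, f (φ a) * (μ (P ⁻¹' {a}) / μ ((fun x => φ (P x)) ⁻¹' {φ a}))
      = ∑' a, f (φ a) / μ ((fun x => φ (P x)) ⁻¹' {φ a}) * μ (P ⁻¹' {a}) := by
    congr with a
    simp only [div_eq_mul_inv]
    ring
  rw [h3, ← h1, h2, tsum_fintype]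
  exact Finset.sum_le_sum fun b _ => (mul_comm _ _).trans_le ENNReal.mul_div_le

lemma tsum_markovWeight_le_one (hT : MeasurePreserving T μ μ) (hP : Measurable P) (φ : ι → α)
    (k m : ℕ) (v : Fin m → ι) : ∑' a, markovWeight μ T P φ k m a v ≤ 1 := by
  unfold markovWeight
  split_ifs with h
  · have hQ : Measurable fun x => φ (P x) := Measurable.of_discrete.comp hP
    set Q : Ω → α := fun x => φ (P x)
    set v' : Fin k → α := fun i => φ (v (Fin.castLE h i))
    refine (tsum_comp_mul_div_le hP fun b =>
      μ (itinerary T Q (k + 1) ⁻¹' {Fin.cons b v'}) / μ (itinerary T Q k ⁻¹' {v'})).trans ?_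
    have h1 : ∀ b, itinerary T Q (k + 1) ⁻¹' {Fin.cons b v'}
        = Q ⁻¹' {b} ∩ T ⁻¹' (itinerary T Q k ⁻¹' {v'}) := by
      intro b
      ext x
      simp [itinerary_succ, Fin.cons_inj]
    have h2 := tsum_measure_preimage_inter (μ := μ) hQ (T ⁻¹' (itinerary T Q k ⁻¹' {v'}))
    rw [hT.measure_preimage (measurable_itinerary hT.measurable hQ k
      (measurableSet_singleton _)).nullMeasurableSet, tsum_fintype] at h2
    simp_rw [h1, div_eq_mul_inv]
    rw [← Finset.sum_mul, h2, ← div_eq_mul_inv]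
    exact ENNReal.div_self_le_one
  · have := tsum_measure_preimage_inter (μ := μ) hP univ
    simp only [inter_univ, measure_univ] at this
    exact this.le

/-- The first n letters have at least k letters to their right and contribute Markov steps; the last
k are weighted independently by μ(P = a), which gives the difference of Birkhoff sums. -/
lemma toReal_chainWeight_markovWeight (φ : ι → α) (k : ℕ) {x : Ω}
    (hx : ∀ i, μ (P ⁻¹' {P (T^[i] x)}) ≠ 0)
    (hx1 : ∀ i, μ ((fun y => φ (P y)) ⁻¹' {φ (P (T^[i] x))}) ≠ 0)
    (hx2 : ∀ n i, μ (itinerary T (fun y => φ (P y)) n ⁻¹'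
      {itinerary T (fun y => φ (P y)) n (T^[i] x)}) ≠ 0) (n : ℕ) :
    (chainWeight (markovWeight μ T P φ k) (n + k) (itinerary T P (n + k) x)).toReal
      = Real.exp (-(birkhoffSum T (markovInfo μ T P φ k) n x
        + (birkhoffSum T (info μ P) (n + k) x - birkhoffSum T (info μ P) n x))) := by
  induction n generalizing x with
  | zero =>
    simp only [zero_add, birkhoffSum_zero, sub_zero]
    have : ∀ j ≤ k, ∀ y, (∀ i, μ (P ⁻¹' {P (T^[i] y)}) ≠ 0) →
        (chainWeight (markovWeight μ T P φ k) j (itinerary T P j y)).toReal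
          = Real.exp (-birkhoffSum T (info μ P) j y) := by
      intro j
      induction j with
      | zero => simp [chainWeight]
      | succ j ih =>
        intro hj y hy
        rw [chainWeight_itinerary_succ, ENNReal.toReal_mul, toReal_markovWeight_of_lt φ hj (x := y) (hy 0),
          ih (by omega) _ (fun i => hy (i + 1)), birkhoffSum_succ', neg_add, Real.exp_add]
    rw [Nat.zero_add]
    exact this k le_rfl x hx
  | succ n ih =>
    rw [Nat.add_right_comm, chainWeight_itinerary_succ, ENNReal.toReal_mul,
      ih (fun i => hx (i + 1)) (fun i => hx1 (i + 1)) (fun m i => hx2 m (i + 1)),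
      toReal_markovWeight_of_le φ (Nat.le_add_left k n) (x := x) (hx 0) (hx1 0) (fun m => hx2 m 0)
        (fun m => hx2 m 1), birkhoffSum_succ', birkhoffSum_succ', birkhoffSum_succ',
      ← Real.exp_add]
    congr 1
    ring

lemma integral_markovInfo (hT : MeasurePreserving T μ μ) (hP : Measurable P)
    (hPi : Integrable (info μ P) μ) (φ : ι → α) (k : ℕ) :
    Integrable (markovInfo μ T P φ k) μ ∧ ∫ x, markovInfo μ T P φ k x ∂μ
      = entropy μ (itinerary T (fun y => φ (P y)) (k + 1))
        - entropy μ (itinerary T (fun y => φ (P y)) k)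
        + (entropy μ P - entropy μ (fun y => φ (P y))) := by
  have hQ : Measurable fun x => φ (P x) := Measurable.of_discrete.comp hP
  have hi := measurable_itinerary hT.measurable hQ
  have h1 := integrable_info_finite (μ := μ) (hi (k + 1))
  have h2 : Integrable (fun x => info μ (itinerary T (fun y => φ (P y)) k) (T x)) μ :=
    hT.integrable_comp_of_integrable (integrable_info_finite (hi k))
  have h3 := integrable_info_finite (μ := μ) hQ
  refine ⟨(h1.sub h2).add (hPi.sub h3), ?_⟩
  refine (integral_add (h1.sub h2) (hPi.sub h3)).trans ?_
  rw [integral_sub' h1 h2, integral_sub' hPi h3,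
    integral_comp_of_measurePreserving hT (measurable_info (hi k)).aestronglyMeasurable]
  rfl

/-- The upper half of the Shannon-McMillan-Breiman theorem for a countable partition, in terms of
a finite coarsening. -/
theorem ae_eventually_info_itinerary_le (hT : Ergodic T μ) (hP : Measurable P)
    (hPi : Integrable (info μ P) μ) (φ : ι → α) {c : ℝ}
    (hc : predEntropy μ T (fun x => φ (P x)) + (entropy μ P - entropy μ fun x => φ (P x)) < c) :
    ∀ᵐ x ∂μ, ∀ᶠ n : ℕ in atTop, info μ (itinerary T P n) x ≤ n * c := by
  have hTm := hT.measurable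
  have hTp := hT.toMeasurePreserving
  have hQ : Measurable fun x => φ (P x) := Measurable.of_discrete.comp hP
  -- The order k is taken so large that the entropy increment at k, plus H(P) - H(φ ∘ P), is still
  -- below c.
  obtain ⟨k, hk⟩ := ((tendsto_entropy_itinerary_succ_sub hTp hQ).eventually_lt_const
    (lt_sub_iff_add_lt.2 hc)).exists
  obtain ⟨hρ, hρi⟩ := integral_markovInfo hTp hP hPi φ k
  have hR : ∫ x, markovInfo μ T P φ k x ∂μ < c := by linarith
  set R := ∫ x, markovInfo μ T P φ k x ∂μ
  set J := ∫ x, info μ P x ∂μ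
  -- Error budget per step: one δ for the Markov sum, two for the boundary sums of `info μ P`, one
  -- for the logarithm, and one to absorb the constant k(J + 2δ).
  obtain ⟨δ, hδ, hδc⟩ : ∃ δ > 0, R + 5 * δ = c := ⟨(c - R) / 5, by linarith, by ring⟩
  have hmk : Measurable (markovInfo μ T P φ k) :=
    ((measurable_info (measurable_itinerary hTm hQ _)).sub
      ((measurable_info (measurable_itinerary hTm hQ _)).comp hTm)).add
      ((measurable_info hP).sub (measurable_info hQ))
  have hall : ∀ {p : Ω → Prop}, (∀ᵐ x ∂μ, p x) → ∀ᵐ x ∂μ, ∀ i, p (T^[i] x) := fun h =>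
    ae_all_iff.2 fun i => (hT.quasiMeasurePreserving.iterate i).ae h
  filter_upwards [ae_eventually_info_le_of_weight (μ := μ) hTm hP
      (tsum_chainWeight_le_one (tsum_markovWeight_le_one hTp hP φ k)),
    hall (ae_measure_fibre_ne_zero (μ := μ) P),
    hall (ae_measure_fibre_ne_zero (μ := μ) fun x => φ (P x)),
    ae_all_iff.2 fun n => hall
      (ae_measure_fibre_ne_zero (μ := μ) (itinerary T (fun x => φ (P x)) n)),
    ae_all_iff.2 fun n => ae_measure_fibre_ne_zero (μ := μ) (itinerary T P n),
    ae_tendsto_birkhoffSum_div hT hmk hρ, ae_tendsto_birkhoffSum_div hT (measurable_info hP) hPi]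
    with x hx hx0 hx1 hx2 hx3 hbρ hbP
  have hlin : Tendsto (fun n : ℕ => (n : ℝ) * δ) atTop atTop :=
    tendsto_natCast_atTop_atTop.atTop_mul_const hδ
  filter_upwards [(tendsto_add_atTop_nat k).eventually hx,
    (tendsto_add_atTop_nat k).eventually (eventually_log_sq_le hδ),
    hbρ.eventually_lt_const (lt_add_of_pos_right R hδ),
    hbP.eventually_const_lt (sub_lt_self J hδ),
    (tendsto_add_atTop_nat k).eventually (hbP.eventually_lt_const (lt_add_of_pos_right J hδ)),
    hlin.eventually_ge_atTop (k * (J + 2 * δ)), eventually_gt_atTop 0]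
    with n h1 h2 h3 h4 h5 h6 h7
  have h7' : (0 : ℝ) < n := by exact_mod_cast h7
  have h7k : (0 : ℝ) < ((n + k : ℕ) : ℝ) := by exact_mod_cast Nat.add_pos_left h7 k
  rw [div_lt_iff₀ h7'] at h3
  rw [lt_div_iff₀ h7'] at h4
  rw [div_lt_iff₀ h7k] at h5
  have h8 := toReal_chainWeight_markovWeight φ k hx0 hx1 hx2 n
  rw [h8, Real.log_exp] at h1
  have h9 := h1 (Real.exp_pos _)
  have h10 : info μ (itinerary T P n) x ≤ info μ (itinerary T P (n + k)) x := by
    rw [info_itinerary, info_itinerary]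
    refine neg_le_neg (Real.log_le_log ?_ (measureReal_mono (cylinder_anti (Nat.le_add_right n k) x)))
    rw [cylinder_eq_preimage]
    exact ENNReal.toReal_pos (hx3 _) (measure_ne_top _ _)
  push_cast at h2 h5 h9
  rw [← hδc]
  nlinarith

end UpperBound

/-! ### Approximation of finite partitions by a generator -/

section Generating

open scoped symmDiff

variable {Ω ι : Type*} {T : Ω → Ω} {P : Ω → ι}

/-- Whether `Tʲ x` belongs to `B` depends only on the first `m` labels of `x`. -/
def IsDetermined (T : Ω → Ω) (P : Ω → ι) (j m : ℕ) (B : Set Ω) : Prop :=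
  ∀ x y, itinerary T P m x = itinerary T P m y → (T^[j] x ∈ B ↔ T^[j] y ∈ B)

lemma IsDetermined.mono {j m : ℕ} {B : Set Ω} (h : IsDetermined T P j m B) {j' m' : ℕ}
    (hj : j ≤ j') (hm : m + j' ≤ m') : IsDetermined T P j' m' B := by
  intro x y hxy
  obtain ⟨i, rfl⟩ := Nat.exists_eq_add_of_le hj
  rw [Function.iterate_add_apply, Function.iterate_add_apply]
  refine h _ _ ?_
  funext l
  have := congrFun hxy ⟨l + i, by omega⟩
  simpa [itinerary, Function.iterate_add_apply] using this

variable [MeasurableSpace Ω] {μ : Measure Ω}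

/-- The algebra of measurable sets which, after pulling back by some iterate of `T`, depend on
finitely many labels only. -/
def determinedSets (T : Ω → Ω) (P : Ω → ι) : Set (Set Ω) :=
  {B | MeasurableSet B ∧ ∃ j m, IsDetermined T P j m B}

lemma isSetAlgebra_determinedSets : IsSetAlgebra (determinedSets T P) where
  empty_mem := ⟨MeasurableSet.empty, 0, 0, fun _ _ _ => Iff.rfl⟩
  compl_mem := fun _ ⟨hs, j, m, h⟩ => ⟨hs.compl, j, m, fun x y hxy => not_congr (h x y hxy)⟩
  union_mem := fun _ _ ⟨hs, j, m, h⟩ ⟨ht, j', m', h'⟩ =>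
    ⟨hs.union ht, j + j', m + m' + (j + j'), fun x y hxy => or_congr
      (h.mono (by omega) (by omega) x y hxy) (h'.mono (by omega) (by omega) x y hxy)⟩

variable [MeasurableSpace ι]

/-- The shift j in `IsDetermined` covers the invertible case: an event about the label at time -i
becomes, after pulling back by Tⁱ, an event about the label at time 0. -/
lemma IsGenerating.isFullModNull_generateFrom (hT : Measurable T) (hP : Measurable P)
    (h : IsGenerating μ T P) :
    IsFullModNull μ (MeasurableSpace.generateFrom (determinedSets T P)) := by
  have h1 : (⨆ i : ℕ, MeasurableSpace.comap (fun x => P (T^[i] x)) inferInstance)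
      ≤ MeasurableSpace.generateFrom (determinedSets T P) := by
    refine iSup_le fun i => ?_
    rintro _ ⟨s, hs, rfl⟩
    refine MeasurableSpace.measurableSet_generateFrom
      ⟨(hP.comp (hT.iterate i)) hs, 0, i + 1, fun x y hxy => ?_⟩
    have := congrFun hxy (Fin.last i)
    simp only [itinerary, Fin.val_last] at this
    simp [this]
  rcases h with h | ⟨e, he, h⟩
  · exact fun B hB => (h B hB).imp fun C hC => ⟨h1 C hC.1, hC.2⟩
  · have h2 : (⨆ i : ℕ, MeasurableSpace.comap (fun x => P (e.symm^[i] x)) inferInstance)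
        ≤ MeasurableSpace.generateFrom (determinedSets T P) := by
      refine iSup_le fun i => ?_
      rintro _ ⟨s, hs, rfl⟩
      refine MeasurableSpace.measurableSet_generateFrom
        ⟨(hP.comp (e.symm.measurable.iterate i)) hs, i, 1, fun x y hxy => ?_⟩
      have hinv : ∀ z, e.symm^[i] (T^[i] z) = z :=
        Function.LeftInverse.iterate (fun z => by rw [← he, e.symm_apply_apply]) i
      have := congrFun hxy 0
      simp only [itinerary, Fin.val_zero, Function.iterate_zero, id] at this
      simp only [mem_preimage, hinv, this]
    exact fun B hB => (h B hB).imp fun C hC => ⟨sup_le h1 h2 C hC.1, hC.2⟩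

lemma IsGenerating.exists_determinedSets [IsFiniteMeasure μ] (hT : Measurable T)
    (hP : Measurable P) (h : IsGenerating μ T P) {B : Set Ω} (hB : MeasurableSet B) {ε : ℝ}
    (hε : 0 < ε) : ∃ C ∈ determinedSets T P, μ (B ∆ C) < ENNReal.ofReal ε := by
  obtain ⟨B', hB', hBB'⟩ := h.isFullModNull_generateFrom hT hP B hB
  have hle : MeasurableSpace.generateFrom (determinedSets T P) ≤ ‹MeasurableSpace Ω› :=
    MeasurableSpace.generateFrom_le fun C hC => hC.1
  have hdense : @Measure.MeasureDense Ω (MeasurableSpace.generateFrom (determinedSets T P))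
      (μ.trim hle) (determinedSets T P) :=
    @Measure.MeasureDense.of_generateFrom_isSetAlgebra_finite Ω
      (MeasurableSpace.generateFrom (determinedSets T P)) (μ.trim hle) _
      (isFiniteMeasure_trim hle) isSetAlgebra_determinedSets rfl
  obtain ⟨C, hC, hlt⟩ := @Measure.MeasureDense.approx Ω
    (MeasurableSpace.generateFrom (determinedSets T P)) _ _ hdense B' hB'
    (ne_top_of_le_ne_top (measure_ne_top μ univ)
      ((measure_mono (subset_univ _)).trans (trim_measurableSet_eq hle .univ).le)) ε hε
  refine ⟨C, hC, ?_⟩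
  rw [trim_measurableSet_eq hle (@MeasurableSet.symmDiff _ (MeasurableSpace.generateFrom _) _ _ hB'
    (MeasurableSpace.measurableSet_generateFrom hC))] at hlt
  exact (measure_congr (ae_eq_set_symmDiff hBB' (ae_eq_refl C))).trans_lt hlt

variable {α : Type*} [Fintype α] [MeasurableSpace α] [DiscreteMeasurableSpace α]
  [IsProbabilityMeasure μ]

lemma IsGenerating.exists_itinerary_approx (hT : MeasurePreserving T μ μ) (hP : Measurable P)
    (h : IsGenerating μ T P) {R : Ω → α} (hR : Measurable R) {ε : ℝ} (hε : 0 < ε) :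
    ∃ (J M : ℕ) (ψ : (Fin M → ι) → α),
      μ {x | R (T^[J] x) ≠ ψ (itinerary T P M x)} ≤ ENNReal.ofReal ε := by
  classical
  have hΩ : Nonempty Ω := nonempty_of_isProbabilityMeasure μ
  set a₀ : α := R hΩ.some
  set δ : ℝ := ε / (Fintype.card α + 1)
  have hδ : 0 < δ := by positivity
  choose C hC hCμ using fun a =>
    h.exists_determinedSets hT.measurable hP (hR (measurableSet_singleton a)) hδ
  choose hCm j m hdet using hC
  set J := ∑ a, j a
  set M := ∑ a, m a + J
  have hdet' : ∀ a, IsDetermined T P J M (C a) := fun a =>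
    (hdet a).mono (Finset.single_le_sum (f := j) (fun _ _ => Nat.zero_le _) (Finset.mem_univ a))
      (Nat.add_le_add_right
        (Finset.single_le_sum (f := m) (fun _ _ => Nat.zero_le _) (Finset.mem_univ a)) _)
  -- Off the exceptional set exactly one a satisfies T^J x ∈ C a, namely the true label; elsewhere
  -- the choice and the default a₀ are irrelevant.
  set sel : (α → Prop) → α := fun p => if hp : ∃ a, p a then hp.choose else a₀
  set S : Ω → α := fun x => sel fun a => T^[J] x ∈ C a
  have hS : Function.FactorsThrough S (itinerary T P M) := fun x y hxy => by
    simp only [S]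
    congr 1
    funext a
    exact propext (hdet' a x y hxy)
  refine ⟨J, M, Function.extend (itinerary T P M) S fun _ => a₀, ?_⟩
  simp_rw [hS.extend_apply]
  have hsub : {x | R (T^[J] x) ≠ S x} ⊆ T^[J] ⁻¹' ⋃ a, (R ⁻¹' {a}) ∆ C a := by
    intro x hx
    by_contra hx'
    simp only [mem_preimage, mem_iUnion, not_exists, mem_symmDiff, mem_singleton_iff, not_or,
      not_and, not_not] at hx'
    have hp : (fun a => T^[J] x ∈ C a) = fun a => R (T^[J] x) = a := by
      funext a
      exact propext ⟨(hx' a).2, (hx' a).1⟩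
    refine hx ?_
    simp only [S, hp, sel]
    rw [dif_pos ⟨_, rfl⟩]
    exact Exists.choose_spec (p := fun a => R (T^[J] x) = a) _
  refine (measure_mono hsub).trans ?_
  rw [(hT.iterate J).measure_preimage (MeasurableSet.iUnion fun a =>
    (hR (measurableSet_singleton a)).symmDiff (hCm a)).nullMeasurableSet]
  refine (measure_iUnion_le _).trans ?_
  rw [tsum_fintype]
  refine (Finset.sum_le_sum fun a _ => (hCμ a).le).trans ?_
  rw [Finset.sum_const, nsmul_eq_mul, Finset.card_univ, ← ENNReal.ofReal_natCast,
    ← ENNReal.ofReal_mul (by positivity)]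
  refine ENNReal.ofReal_le_ofReal ?_
  rw [← mul_div_assoc, div_le_iff₀ (by positivity)]
  nlinarith

lemma abs_measureReal_sub_le {A B D : Set Ω} (h : A \ B ⊆ D) (h' : B \ A ⊆ D) :
    |μ.real A - μ.real B| ≤ μ.real D := by
  have h1 : ∀ {A B : Set Ω}, A \ B ⊆ D → μ.real A ≤ μ.real B + μ.real D := fun {A B} h =>
    (measureReal_mono (sdiff_subset_iff.1 h)).trans (measureReal_union_le _ _)
  rw [abs_le]
  constructor <;> linarith [h1 h, h1 h']

/-- As R' and S agree up to vanishing measure, their joint law tends to the law of R on the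
diagonal, which has the same entropy as the limit law of S. Finiteness of α and continuity of -t log
t suffice. -/
lemma tendsto_entropy_pair_sub {R : Ω → α} {R' S : ℕ → Ω → α}
    (hR' : ∀ l, Measurable (R' l)) (hS : ∀ l, Measurable (S l))
    (hRR' : ∀ l a, μ.real (R' l ⁻¹' {a}) = μ.real (R ⁻¹' {a}))
    (h : Tendsto (fun l => μ.real {x | R' l x ≠ S l x}) atTop (𝓝 0)) :
    Tendsto (fun l => entropy μ (fun x => (R' l x, S l x)) - entropy μ (S l)) atTop (𝓝 0) := by
  classical
  have h1 : ∀ b, Tendsto (fun l => μ.real (S l ⁻¹' {b})) atTop (𝓝 (μ.real (R ⁻¹' {b}))) := by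
    intro b
    rw [tendsto_iff_dist_tendsto_zero]
    refine squeeze_zero (fun _ => dist_nonneg) (fun l => ?_) h
    rw [Real.dist_eq, ← hRR' l b]
    refine abs_measureReal_sub_le ?_ ?_
    · rintro x ⟨hx, hx'⟩ heq
      exact hx' (heq.trans hx)
    · rintro x ⟨hx, hx'⟩ heq
      exact hx' (heq.symm.trans hx)
  have h2 : ∀ p : α × α, Tendsto (fun l => μ.real ((fun x => (R' l x, S l x)) ⁻¹' {p})) atTop
      (𝓝 (if p.1 = p.2 then μ.real (R ⁻¹' {p.1}) else 0)) := by
    rintro ⟨a, b⟩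
    split_ifs with hab
    · dsimp only at hab ⊢
      subst hab
      rw [tendsto_iff_dist_tendsto_zero]
      refine squeeze_zero (fun _ => dist_nonneg) (fun l => ?_) h
      rw [Real.dist_eq, ← hRR' l a]
      refine abs_measureReal_sub_le ?_ ?_
      · rintro x ⟨hx, hx'⟩ -
        simp only [mem_preimage, mem_singleton_iff, Prod.mk.injEq] at hx hx'
        exact hx' hx.1
      · rintro x ⟨hx, hx'⟩ heq
        simp only [mem_preimage, mem_singleton_iff, Prod.mk.injEq] at hx hx'
        exact hx' ⟨hx, heq.symm.trans hx⟩
    · refine squeeze_zero (fun _ => measureReal_nonneg) (fun l => measureReal_mono ?_) h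
      intro x hx heq
      simp only [mem_preimage, mem_singleton_iff, Prod.mk.injEq] at hx
      exact hab (hx.1.symm.trans (heq.trans hx.2))
  have h3 : Tendsto (fun l => entropy μ (S l)) atTop
      (𝓝 (∑ b, Real.negMulLog (μ.real (R ⁻¹' {b})))) := by
    simp_rw [entropy_eq_sum (hS _)]
    exact tendsto_finsetSum _ fun b _ => (Real.continuous_negMulLog.tendsto _).comp (h1 b)
  have h4 : Tendsto (fun l => entropy μ (fun x => (R' l x, S l x))) atTop
      (𝓝 (∑ p : α × α, Real.negMulLog (if p.1 = p.2 then μ.real (R ⁻¹' {p.1}) else 0))) := by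
    simp_rw [entropy_eq_sum ((hR' _).prodMk (hS _))]
    exact tendsto_finsetSum _ fun p _ => (Real.continuous_negMulLog.tendsto _).comp (h2 p)
  have h5 : ∑ p : α × α, Real.negMulLog (if p.1 = p.2 then μ.real (R ⁻¹' {p.1}) else 0)
      = ∑ b, Real.negMulLog (μ.real (R ⁻¹' {b})) := by
    rw [Fintype.sum_prod_type]
    refine Finset.sum_congr rfl fun a _ => ?_
    rw [Finset.sum_eq_single a] <;> simp +contextual [eq_comm]
  rw [h5] at h4
  simpa using h4.sub h3

lemma IsGenerating.exists_entropy_approx [Countable ι] [DiscreteMeasurableSpace ι]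
    (hT : MeasurePreserving T μ μ) (hP : Measurable P)
    (h : IsGenerating μ T P) {R : Ω → α} (hR : Measurable R) {ε : ℝ} (hε : 0 < ε) :
    ∃ (J M : ℕ) (ψ : (Fin M → ι) → α),
      entropy μ (fun x => (R (T^[J] x), ψ (itinerary T P M x)))
        - entropy μ (fun x => ψ (itinerary T P M x)) < ε := by
  have hpos : ∀ l : ℕ, (0 : ℝ) < 1 / ((l : ℝ) + 1) := fun l => by positivity
  choose J M ψ hψ using fun l : ℕ => h.exists_itinerary_approx hT hP hR (hpos l)
  have hR' : ∀ l, Measurable fun x => R (T^[J l] x) := fun l =>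
    hR.comp (hT.measurable.iterate (J l))
  have hlim := tendsto_entropy_pair_sub (μ := μ) (R := R) (R' := fun l x => R (T^[J l] x))
    (S := fun l x => ψ l (itinerary T P (M l) x)) hR'
    (fun l => Measurable.of_discrete.comp (measurable_itinerary hT.measurable hP (M l)))
    (fun l a => (hT.iterate (J l)).measureReal_preimage
      (hR (measurableSet_singleton a)).nullMeasurableSet)
    (squeeze_zero (fun _ => measureReal_nonneg)
      (fun l => ENNReal.toReal_le_of_le_ofReal (hpos l).le (hψ l))
      tendsto_one_div_add_atTop_nhds_zero_nat)
  obtain ⟨l, hl⟩ := (hlim.eventually_lt_const hε).exists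
  exact ⟨J l, M l, ψ l, hl⟩

end Generating

/-! ### From entropy rates to the Kolmogorov–Sinai entropy -/

section Entropy

variable {Ω ι : Type*} [MeasurableSpace Ω] {μ : Measure Ω} [IsProbabilityMeasure μ]
  {T : Ω → Ω} {P : Ω → ι}
  {α β : Type*} [Fintype α] [MeasurableSpace α] [DiscreteMeasurableSpace α]
  [Fintype β] [MeasurableSpace β] [DiscreteMeasurableSpace β]

lemma predEntropy_comp_iterate (hT : MeasurePreserving T μ μ) {R : Ω → α} (hR : Measurable R)
    (J : ℕ) : predEntropy μ T (fun x => R (T^[J] x)) = predEntropy μ T R := by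
  have hJ := hT.iterate J
  have key : ∀ n, entropy μ (itinerary T (fun x => R (T^[J] x)) n) = entropy μ (itinerary T R n) := by
    intro n
    rw [← entropy_comp_measurePreserving hJ (measurable_itinerary hT.measurable hR n)]
    congr 1
    funext x i
    simp only [itinerary, ← Function.iterate_add_apply, add_comm]
  have h1 := tendsto_entropy_itinerary_succ_sub hT (hR.comp hJ.measurable)
  have h2 := tendsto_entropy_itinerary_succ_sub hT hR
  simp_rw [Function.comp_def, key] at h1
  exact tendsto_nhds_unique h1 h2

/-- Otherwise, at almost every point, the upper half for (R, S) coarsened to S would make the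
cylinders of (R, S) decay strictly more slowly than the lower half forces the larger cylinders of R
to decay. -/
lemma predEntropy_le_add (hT : Ergodic T μ) {R : Ω → α} {S : Ω → β} (hR : Measurable R)
    (hS : Measurable S) :
    predEntropy μ T R ≤ predEntropy μ T S + (entropy μ (fun x => (R x, S x)) - entropy μ S) := by
  by_contra! hlt
  obtain ⟨c, hc1, hc2⟩ := exists_between hlt
  obtain ⟨d, hd1, hd2⟩ := exists_between hc2
  have hRS := hR.prodMk hS
  have h1 := ae_eventually_info_itinerary_le hT hRS (integrable_info_finite hRS) Prod.snd hc1
  have h2 := ae_eventually_le_info_itinerary hT hR hd2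
  have h3 : ∀ᵐ x ∂μ, ∀ n, info μ (itinerary T R n) x
      ≤ info μ (itinerary T (fun y => (R y, S y)) n) x :=
    ae_all_iff.2 fun n => ae_info_comp_le (μ := μ) (itinerary T (fun y => (R y, S y)) n)
      fun w i => (w i).1
  obtain ⟨x, hx1, hx2, hx3⟩ := (h1.and (h2.and h3)).exists
  obtain ⟨n, ⟨hn1, hn2⟩, hn3⟩ := ((hx1.and hx2).and (eventually_gt_atTop 0)).exists
  have h4 := hn2.trans ((hx3 n).trans hn1)
  have hn3' : (0 : ℝ) < n := by exact_mod_cast hn3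
  exact absurd (le_of_mul_le_mul_left h4 hn3') (not_le.2 hd1)

variable [Countable ι] [MeasurableSpace ι] [DiscreteMeasurableSpace ι]

/-- The measures of the cylinders of a generating partition decay at least at the rate given by
the entropy. -/
theorem ae_eventually_le_info_of_lt_metricEntropy (hT : Ergodic T μ) (hP : Measurable P)
    (hgen : IsGenerating μ T P) {c : ℝ} (hc : ENNReal.ofReal c < metricEntropy μ T) :
    ∀ᵐ z ∂μ, ∀ᶠ n : ℕ in atTop, n * c ≤ info μ (itinerary T P n) z := by
  simp only [metricEntropy, lt_iSup_iff] at hc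
  obtain ⟨k, R, hR, hc⟩ := hc
  rw [entropyRate_eq_ofReal_predEntropy hT.toMeasurePreserving hR] at hc
  have hcR := (ENNReal.ofReal_lt_ofReal_iff'.1 hc).1
  obtain ⟨J, M, ψ, hψ⟩ := hgen.exists_entropy_approx hT.toMeasurePreserving hP hR (sub_pos.2 hcR)
  have hS : Measurable fun x => ψ (itinerary T P M x) :=
    (Measurable.of_discrete (f := ψ)).comp (measurable_itinerary hT.measurable hP M)
  have hle := predEntropy_le_add hT (hR.comp (hT.measurable.iterate J)) hS
  simp only [Function.comp_def] at hle
  rw [predEntropy_comp_iterate hT.toMeasurePreserving hR] at hle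
  have hcS : c < predEntropy μ T fun x => ψ (itinerary T P M x) := by linarith
  obtain ⟨d, hcd, hd⟩ := exists_between hcS
  -- The first n labels of S are read off the first n + M labels of P; the loss of M steps is later
  -- absorbed by n(d - c).
  have hinfo : ∀ᵐ x ∂μ, ∀ n, info μ (itinerary T (fun y => ψ (itinerary T P M y)) n) x
      ≤ info μ (itinerary T P (n + M)) x := by
    refine ae_all_iff.2 fun n => ?_
    refine (ae_info_comp_le (μ := μ) (itinerary T P (n + M))
      fun w (i : Fin n) => ψ fun j : Fin M => w ⟨i + j, by omega⟩).mono fun x hx => ?_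
    convert hx using 2
    funext y i
    simp only [itinerary]
    congr 1
    funext j
    rw [add_comm, Function.iterate_add_apply]
    rfl
  filter_upwards [ae_eventually_le_info_itinerary hT hS hd, hinfo] with x hx hxi
  have hlin : Tendsto (fun n : ℕ => (n : ℝ) * (d - c)) atTop atTop :=
    tendsto_natCast_atTop_atTop.atTop_mul_const (sub_pos.2 hcd)
  filter_upwards [(tendsto_sub_atTop_nat M).eventually hx, hlin.eventually_ge_atTop (M * d),
    eventually_ge_atTop M] with n h1 h2 h3
  have h4 := h1.trans (hxi (n - M))
  rw [Nat.sub_add_cancel h3, Nat.cast_sub h3] at h4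
  linarith

/-- The entropy of a countable partition of finite entropy is approximated by that of its finite
coarsenings. -/
lemma exists_coarsening_entropy_lt (hP : Measurable P) (hPi : Integrable (info μ P) μ) {ε : ℝ}
    (hε : 0 < ε) :
    ∃ (N : ℕ) (φ : ι → Fin (N + 1)), entropy μ P - entropy μ (fun x => φ (P x)) < ε := by
  obtain ⟨enc, henc⟩ := exists_injective_nat ι
  set φ : ∀ N : ℕ, ι → Fin (N + 1) := fun N i =>
    ⟨min (enc i) N, Nat.lt_succ_of_le (min_le_right _ _)⟩
  have hφ : ∀ N, Measurable fun x => φ N (P x) := fun N =>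
    (Measurable.of_discrete (f := φ N)).comp hP
  -- All labels with code at least N are merged. At a fixed x the difference is 0 once N exceeds the
  -- code of P x, and it is dominated by `info μ P`.
  have hlim : Tendsto (fun N => ∫ x, (info μ P x - info μ (fun y => φ N (P y)) x) ∂μ) atTop
      (𝓝 (∫ _, (0 : ℝ) ∂μ)) := by
    refine tendsto_integral_of_dominated_convergence (info μ P) ?_ hPi ?_ ?_
    · exact fun N => ((measurable_info hP).sub (measurable_info (hφ N))).aestronglyMeasurable
    · intro N
      filter_upwards [ae_info_comp_le (μ := μ) P (φ N)] with x hx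
      rw [Real.norm_of_nonneg (sub_nonneg.2 hx)]
      exact sub_le_self _ (info_nonneg _ _)
    · refine Eventually.of_forall fun x => tendsto_const_nhds.congr' ?_
      filter_upwards [eventually_gt_atTop (enc (P x))] with N hN
      have : (fun y => φ N (P y)) ⁻¹' {φ N (P x)} = P ⁻¹' {P x} := by
        ext y
        simp only [mem_preimage, mem_singleton_iff, φ, Fin.mk.injEq]
        rw [← henc.eq_iff]
        omega
      simp only [info, this, sub_self]
  rw [integral_zero] at hlim
  obtain ⟨N, hN⟩ := (hlim.eventually_lt_const hε).exists
  refine ⟨N, φ N, ?_⟩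
  rwa [integral_sub hPi (integrable_info_finite (hφ N))] at hN

/-- The measures of the cylinders of a partition of finite entropy decay at most at the rate given
by the entropy. -/
theorem ae_eventually_info_le_of_metricEntropy_lt (hT : Ergodic T μ) (hP : Measurable P)
    (hH : partitionEntropy μ P < ∞) {c : ℝ} (hc : metricEntropy μ T < ENNReal.ofReal c) :
    ∀ᵐ z ∂μ, ∀ᶠ n : ℕ in atTop, info μ (itinerary T P n) z ≤ n * c := by
  have hPi := integrable_info hP hH
  have hlt : (metricEntropy μ T).toReal < c := (ENNReal.lt_ofReal_iff_toReal_lt hc.ne_top).1 hc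
  obtain ⟨N, φ, hφ⟩ := exists_coarsening_entropy_lt hP hPi (sub_pos.2 hlt)
  have hQ : Measurable fun x => φ (P x) := Measurable.of_discrete.comp hP
  refine ae_eventually_info_itinerary_le hT hP hPi φ ?_
  have h1 : ENNReal.ofReal (predEntropy μ T fun x => φ (P x)) ≤ metricEntropy μ T := by
    rw [← entropyRate_eq_ofReal_predEntropy hT.toMeasurePreserving hQ]
    exact le_iSup_of_le (N + 1) (le_iSup_of_le _ (le_iSup_of_le hQ le_rfl))
  have h2 := (ENNReal.ofReal_le_iff_le_toReal hc.ne_top).1 h1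
  linarith

end Entropy

/-! ### Entrance times and Borel–Cantelli -/

section EntranceTimes

variable {Ω ι : Type*} {T : Ω → Ω} {P : Ω → ι}

lemma one_le_entranceTime (A : Set Ω) (x : Ω) : 1 ≤ entranceTime T A x :=
  le_iInf₂ fun i hi => by exact_mod_cast hi.1

lemma exists_of_entranceTime_le {A : Set Ω} {x : Ω} {N : ℕ} (h : entranceTime T A x ≤ N) :
    ∃ i, (1 ≤ i ∧ i ≤ N) ∧ T^[i] x ∈ A := by
  by_contra! hc
  have : ((N + 1 : ℕ) : ℕ∞) ≤ entranceTime T A x := le_iInf₂ fun i hi => by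
    by_contra! hlt
    have hlt' : i < N + 1 := by exact_mod_cast hlt
    exact hc i ⟨hi.1, by omega⟩ hi.2
  have h2 : N + 1 ≤ N := by exact_mod_cast this.trans h
  omega

variable [MeasurableSpace Ω] {μ : Measure Ω}

lemma measure_entranceTime_le (hT : MeasurePreserving T μ μ) {A : Set Ω} (hA : MeasurableSet A)
    {s : ℝ} (hs : 0 ≤ s) :
    μ {x | ((entranceTime T A x : ℕ∞) : ℝ≥0∞) ≤ ENNReal.ofReal s} ≤ ENNReal.ofReal s * μ A := by
  have hsub : {x | ((entranceTime T A x : ℕ∞) : ℝ≥0∞) ≤ ENNReal.ofReal s}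
      ⊆ ⋃ i ∈ Finset.Icc 1 ⌊s⌋₊, T^[i] ⁻¹' A := by
    intro x hx
    have hx' : ((entranceTime T A x : ℕ∞) : ℝ≥0∞) ≤ ENNReal.ofReal s := hx
    have hle : entranceTime T A x ≤ (⌊s⌋₊ : ℕ) := by
      obtain ⟨m, hm⟩ := ENat.ne_top_iff_exists.1
        (fun h : entranceTime T A x = ⊤ => by simp [h] at hx')
      rw [← hm] at hx' ⊢
      rw [ENat.toENNReal_coe, ← ENNReal.ofReal_natCast, ENNReal.ofReal_le_ofReal_iff hs] at hx'
      exact_mod_cast Nat.le_floor hx'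
    obtain ⟨i, hi, hxi⟩ := exists_of_entranceTime_le hle
    exact mem_iUnion₂.2 ⟨i, Finset.mem_Icc.2 hi, hxi⟩
  refine (measure_mono hsub).trans ((measure_biUnion_finset_le _ _).trans ?_)
  have : ∀ i ∈ Finset.Icc 1 ⌊s⌋₊, μ (T^[i] ⁻¹' A) = μ A := fun i _ =>
    (hT.iterate i).measure_preimage hA.nullMeasurableSet
  rw [Finset.sum_congr rfl this, Finset.sum_const, Nat.card_Icc, nsmul_eq_mul,
    Nat.add_sub_cancel, ← ENNReal.ofReal_natCast]
  gcongr
  exact Nat.floor_le hs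

lemma ae_eventually_notMem_of_eventually_le {s : ℕ → Set Ω} {b : ℕ → ℝ≥0∞} (hb : ∑' n, b n ≠ ∞)
    (h : ∀ᶠ n in atTop, μ (s n) ≤ b n) : ∀ᵐ x ∂μ, ∀ᶠ n in atTop, x ∉ s n := by
  obtain ⟨N, hN⟩ := eventually_atTop.1 h
  have h1 : ∑' n, μ (s (n + N)) ≠ ∞ :=
    ne_top_of_le_ne_top hb ((ENNReal.tsum_le_tsum fun n => hN _ (Nat.le_add_left N n)).trans
      (ENNReal.tsum_comp_le_tsum_of_injective (add_left_injective N) b))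
  filter_upwards [ae_eventually_notMem h1] with x hx
  obtain ⟨M, hM⟩ := eventually_atTop.1 hx
  refine eventually_atTop.2 ⟨M + N, fun n hn => ?_⟩
  have := hM (n - N) (by omega)
  rwa [Nat.sub_add_cancel (by omega)] at this

lemma measure_cylinder_le_of_le_info [IsFiniteMeasure μ] {n : ℕ} {z : Ω} {c : ℝ}
    (h : c ≤ info μ (itinerary T P n) z) :
    μ (cylinder T P n z) ≤ ENNReal.ofReal (Real.exp (-c)) := by
  rw [info_itinerary] at h
  rw [← ENNReal.ofReal_toReal (measure_ne_top μ (cylinder T P n z)), ← measureReal_def]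
  refine ENNReal.ofReal_le_ofReal ?_
  rcases (measureReal_nonneg (μ := μ) (s := cylinder T P n z)).eq_or_lt with h0 | h0
  · rw [← h0]
    positivity
  · rw [← Real.log_le_iff_le_exp h0]
    linarith

lemma le_measure_cylinder_of_info_le [IsFiniteMeasure μ] {n : ℕ} {z : Ω} {c : ℝ}
    (h0 : μ (cylinder T P n z) ≠ 0) (h : info μ (itinerary T P n) z ≤ c) :
    ENNReal.ofReal (Real.exp (-c)) ≤ μ (cylinder T P n z) := by
  rw [info_itinerary] at h
  rw [← ENNReal.ofReal_toReal (measure_ne_top μ (cylinder T P n z)), ← measureReal_def]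
  refine ENNReal.ofReal_le_ofReal ?_
  rw [measureReal_def, ← Real.le_log_iff_exp_le (ENNReal.toReal_pos h0 (measure_ne_top _ _)),
    ← measureReal_def]
  linarith

lemma measurableSet_cylinder [MeasurableSpace ι] [Countable ι] [DiscreteMeasurableSpace ι]
    (hT : Measurable T) (hP : Measurable P) (n : ℕ) (z : Ω) : MeasurableSet (cylinder T P n z) := by
  rw [cylinder_eq_preimage]
  exact measurable_itinerary hT hP n (measurableSet_singleton _)

lemma log_ofReal_exp (x : ℝ) : ENNReal.log (ENNReal.ofReal (Real.exp x)) = x := by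
  rw [ENNReal.log_ofReal_of_pos (Real.exp_pos x), Real.log_exp]

/-- Exponentially fast decay of the cylinders around `z` bounds their entrance times below. -/
lemma ae_eventually_le_log_entranceTime [IsProbabilityMeasure μ] [MeasurableSpace ι] [Countable ι]
    [DiscreteMeasurableSpace ι] (hT : MeasurePreserving T μ μ) (hP : Measurable P) {z : Ω}
    {c d : ℝ} (hcd : c < d) (hz : ∀ᶠ n : ℕ in atTop, n * d ≤ info μ (itinerary T P n) z) :
    ∀ᵐ x ∂μ, ∀ᶠ n : ℕ in atTop, ((n * c : ℝ) : EReal) ≤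
      ENNReal.log ((entranceTime T (cylinder T P n z) x : ℕ∞) : ℝ≥0∞) := by
  have hsum : ∑' n : ℕ, ENNReal.ofReal (Real.exp (n * (c - d))) ≠ ∞ :=
    Summable.tsum_ofReal_ne_top (Real.summable_exp_nat_mul_iff.2 (sub_neg.2 hcd))
  have h := ae_eventually_notMem_of_eventually_le (μ := μ) (s := fun n : ℕ =>
    {x | ((entranceTime T (cylinder T P n z) x : ℕ∞) : ℝ≥0∞)
      ≤ ENNReal.ofReal (Real.exp (n * c))}) hsum (by
    filter_upwards [hz] with n hn
    refine (measure_entranceTime_le hT (measurableSet_cylinder hT.measurable hP n z)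
      (Real.exp_pos _).le).trans ?_
    refine (mul_le_mul_right (measure_cylinder_le_of_le_info hn) _).trans ?_
    rw [← ENNReal.ofReal_mul (Real.exp_pos _).le, ← Real.exp_add]
    refine ENNReal.ofReal_le_ofReal (Real.exp_le_exp.2 (by linarith)))
  filter_upwards [h] with x hx
  filter_upwards [hx] with n hn
  rw [← log_ofReal_exp]
  exact ENNReal.log_monotone (not_le.1 hn).le

/-- Summability of the entrance times distributions at exponential times bounds the entrance times
above. -/
lemma ae_eventually_log_entranceTime_le [IsProbabilityMeasure μ] {z : Ω} {d ε : ℝ}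
    (h0 : ∀ n, μ (cylinder T P n z) ≠ 0)
    (hz : ∀ᶠ n : ℕ in atTop, info μ (itinerary T P n) z ≤ n * d)
    (hsum : ∑' n : ℕ, ENNReal.ofReal
      (entranceDist μ T P n z (Real.exp (n * ε))) ≠ ∞) :
    ∀ᵐ x ∂μ, ∀ᶠ n : ℕ in atTop,
      ENNReal.log ((entranceTime T (cylinder T P n z) x : ℕ∞) : ℝ≥0∞) ≤ ((n * (d + ε) : ℝ) : EReal) := by
  simp only [entranceDist, ENNReal.ofReal_toReal (measure_ne_top μ _)] at hsum
  filter_upwards [ae_eventually_notMem hsum] with x hx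
  filter_upwards [hx, hz] with n hn hzn
  rw [← log_ofReal_exp]
  refine ENNReal.log_monotone ((not_le.1 hn).le.trans ?_)
  rw [ENNReal.div_le_iff (h0 n) (measure_ne_top _ _)]
  refine le_trans ?_ (mul_le_mul_right (le_measure_cylinder_of_info_le (h0 n) hzn) _)
  rw [← ENNReal.ofReal_mul (Real.exp_pos _).le, ← Real.exp_add]
  refine ENNReal.ofReal_le_ofReal (Real.exp_le_exp.2 (by linarith))

/-- Joint measurability in (x, z) is needed for Fubini; each condition Tⁱx ∈ A_n(z) is an equality
of two itineraries. -/
lemma measurable_entranceTime_cylinder [MeasurableSpace ι] [Countable ι]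
    [DiscreteMeasurableSpace ι] (hT : Measurable T) (hP : Measurable P) (n : ℕ) :
    Measurable fun p : Ω × Ω => entranceTime T (cylinder T P n p.2) p.1 := by
  classical
  have : BorelSpace ℕ∞ := ⟨by
    rw [borel_eq_top_of_countable]
    exact eq_top_iff.2 fun s _ => MeasurableSet.of_discrete⟩
  unfold entranceTime
  refine Measurable.iInf fun i => ?_
  have : (fun p : Ω × Ω => ⨅ (_ : 1 ≤ i ∧ T^[i] p.1 ∈ cylinder T P n p.2), (i : ℕ∞))
      = fun p => if 1 ≤ i ∧ T^[i] p.1 ∈ cylinder T P n p.2 then (i : ℕ∞) else ⊤ := by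
    funext p
    split_ifs with h <;> simp [h]
  rw [this]
  refine Measurable.ite ?_ measurable_const measurable_const
  have h2 : {p : Ω × Ω | 1 ≤ i ∧ T^[i] p.1 ∈ cylinder T P n p.2}
      = {_p | 1 ≤ i} ∩ {p | itinerary T P n (T^[i] p.1) = itinerary T P n p.2} := by
    ext p
    simp [cylinder_eq_preimage]
  rw [h2]
  have hi := measurable_itinerary hT hP n
  exact (MeasurableSet.const _).inter (measurableSet_eq_fun
    (hi.comp ((hT.iterate i).comp measurable_fst)) (hi.comp measurable_snd))

lemma ae_prod_of_ae_ae_right [SFinite μ] {p : Ω × Ω → Prop} (hp : MeasurableSet {q | p q})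
    (h : ∀ᵐ z ∂μ, ∀ᵐ x ∂μ, p (x, z)) : ∀ᵐ q ∂(μ.prod μ), p q := by
  rw [ae_iff]
  have hm : MeasurableSet {q | ¬ p q} := hp.compl
  rw [Measure.prod_apply_symm hm, lintegral_eq_zero_iff (measurable_measure_prodMk_right hm)]
  exact h

end EntranceTimes

/-! ### Summability for almost every z, and the limit from rational bounds -/

section Main

variable {Ω ι : Type*} [MeasurableSpace Ω] {μ : Measure Ω} [IsProbabilityMeasure μ]
  {T : Ω → Ω} {P : Ω → ι}

/-- Summability of the entrance times distributions, from their approximation by `F`. -/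
lemma ae_tsum_entranceDist_ne_top {F : Ω → ℝ → ℝ} {a : Ω → ℕ → ℝ}
    (hFmeas : ∀ t : ℝ, 0 < t → AEMeasurable (fun z => F z t) μ)
    (ha : ∀ᵐ z ∂μ, Summable (a z)) {ε : ℝ}
    (h1 : ∑' n : ℕ, μ {z | a z (n + 1) <
      |entranceDist μ T P (n + 1) z (Real.exp (((n + 1 : ℕ) : ℝ) * ε))
        - F z (Real.exp (((n + 1 : ℕ) : ℝ) * ε))|} < ∞)
    (h2 : ∑' n : ℕ, ∫⁻ z, ENNReal.ofReal (F z (Real.exp (((n + 1 : ℕ) : ℝ) * ε))) ∂μ < ∞) :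
    ∀ᵐ z ∂μ, ∑' n : ℕ, ENNReal.ofReal (entranceDist μ T P n z (Real.exp (n * ε))) ≠ ∞ := by
  have hm : ∀ n : ℕ, AEMeasurable
      (fun z => ENNReal.ofReal (F z (Real.exp (((n + 1 : ℕ) : ℝ) * ε)))) μ := fun n =>
    (hFmeas _ (Real.exp_pos _)).ennreal_ofReal
  rw [← lintegral_tsum hm] at h2
  filter_upwards [ae_eventually_notMem h1.ne, ha, ae_lt_top' (AEMeasurable.tsum hm) h2.ne]
    with z hz1 hz2 hz3
  obtain ⟨N, hN⟩ := eventually_atTop.1 hz1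
  have hsa : ∑' n, ENNReal.ofReal (a z (n + 1)) ≠ ∞ :=
    ((summable_nat_add_iff 1).2 hz2).tsum_ofReal_ne_top
  set u : ℕ → ℝ≥0∞ := fun n => ENNReal.ofReal (entranceDist μ T P n z (Real.exp (n * ε)))
  have hu : ∀ n, N ≤ n → u (n + 1) ≤ ENNReal.ofReal (F z (Real.exp (((n + 1 : ℕ) : ℝ) * ε)))
      + ENNReal.ofReal (a z (n + 1)) := by
    intro n hn
    have h3 : ¬ (a z (n + 1) < _) := hN n hn
    rw [not_lt] at h3
    refine (ENNReal.ofReal_le_ofReal ?_).trans ENNReal.ofReal_add_le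
    linarith [(abs_le.1 h3).2]
  have htail : ∑' n, u (n + (N + 1)) ≠ ∞ := by
    refine ne_top_of_le_ne_top (ENNReal.add_ne_top.2 ⟨hz3.ne, hsa⟩) ?_
    rw [← ENNReal.tsum_add]
    refine le_trans (ENNReal.tsum_le_tsum fun n => hu (n + N) (Nat.le_add_left N n)) ?_
    exact ENNReal.tsum_comp_le_tsum_of_injective (add_left_injective N)
      fun n => ENNReal.ofReal (F z (Real.exp (((n + 1 : ℕ) : ℝ) * ε)))
        + ENNReal.ofReal (a z (n + 1))
  -- The comparison holds only from index N + 1 on; the finitely many earlier terms are finite.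
  rw [← ENNReal.summable.sum_add_tsum_nat_add' (f := u) (k := N + 1)]
  exact ENNReal.add_ne_top.2 ⟨(ENNReal.sum_lt_top.2 fun _ _ => ENNReal.ofReal_lt_top).ne, htail⟩

lemma tendsto_ereal_div_of_eventually_mul {u : ℕ → EReal} {h : ℝ≥0∞} (hu : ∀ n, 0 ≤ u n)
    (hlo : ∀ q : ℚ, ENNReal.ofReal q < h → ∀ᶠ n : ℕ in atTop, ((n * q : ℝ) : EReal) ≤ u n)
    (hup : ∀ q : ℚ, h < ENNReal.ofReal q → ∀ᶠ n : ℕ in atTop, u n ≤ ((n * q : ℝ) : EReal)) :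
    Tendsto (fun n : ℕ => u n / ((n : ℝ) : EReal)) atTop (𝓝 (h : EReal)) := by
  have hpos : ∀ n : ℕ, 0 < n → (0 : EReal) < ((n : ℝ) : EReal) := fun n hn => by
    exact_mod_cast hn
  rw [tendsto_order]
  constructor
  · intro b hb
    -- Negative b need only log τ ≥ 0; for b ≥ 0 the rational above b is nonnegative, so
    -- `ENNReal.ofReal` does not truncate it.
    rcases lt_or_ge b 0 with hb0 | hb0
    · filter_upwards [eventually_gt_atTop 0] with n hn
      exact hb0.trans_le (EReal.div_nonneg (hu n) (hpos n hn).le)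
    · obtain ⟨q, hbq, hqh⟩ := EReal.exists_rat_btwn_of_lt hb
      have hq : (0 : ℝ) ≤ (q : ℝ) := by exact_mod_cast hb0.trans hbq.le
      have hqh' : ENNReal.ofReal q < h := by
        rw [← EReal.coe_ennreal_lt_coe_ennreal_iff, EReal.coe_ennreal_ofReal, max_eq_left hq]
        exact hqh
      filter_upwards [hlo q hqh', eventually_gt_atTop 0] with n hn hn0
      refine hbq.trans_le ?_
      rw [EReal.le_div_iff_mul_le (hpos n hn0) (EReal.coe_ne_top _)]
      refine le_trans (le_of_eq ?_) hn
      rw [mul_comm (n : ℝ) (q : ℝ), EReal.coe_mul]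
  · intro b hb
    obtain ⟨q, hhq, hqb⟩ := EReal.exists_rat_btwn_of_lt hb
    have hq : (0 : ℝ) ≤ (q : ℝ) := by
      exact_mod_cast (EReal.coe_ennreal_nonneg h).trans hhq.le
    have hhq' : h < ENNReal.ofReal q := by
      rw [← EReal.coe_ennreal_lt_coe_ennreal_iff, EReal.coe_ennreal_ofReal, max_eq_left hq]
      exact hhq
    filter_upwards [hup q hhq', eventually_gt_atTop 0] with n hn hn0
    refine lt_of_le_of_lt ?_ hqb
    rw [EReal.div_le_iff_le_mul (hpos n hn0) (EReal.coe_ne_top _)]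
    refine hn.trans (le_of_eq ?_)
    rw [EReal.coe_mul]

end Main

end EntranceTime

end

theorem mainTheorem5 {Ω ι : Type*} [MeasurableSpace Ω]
    [Countable ι] [MeasurableSpace ι] [DiscreteMeasurableSpace ι]
    (μ : Measure Ω) [IsProbabilityMeasure μ] (T : Ω → Ω) (hT : Ergodic T μ)
    (P : Ω → ι) (hP : Measurable P) (hgen : EntranceTime.IsGenerating μ T P)
    (hH : EntranceTime.metricEntropy μ T < ∞ → EntranceTime.partitionEntropy μ P < ∞)
    (F : Ω → ℝ → ℝ) (a : Ω → ℕ → ℝ)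
    (hFmeas : ∀ t : ℝ, 0 < t → AEMeasurable (fun z => F z t) μ)
    (hF : ∀ᵐ z ∂μ, AntitoneOn (F z) (Ioi 0))
    (ha : ∀ᵐ z ∂μ, (∀ n, 0 < a z n) ∧ Summable (a z))
    (hsmall : ∃ ε₀ : ℝ, 0 < ε₀ ∧ ∀ ε : ℝ, 0 < ε → ε < ε₀ →
      (∑' n : ℕ, μ {z | a z (n + 1) <
          |EntranceTime.entranceDist μ T P (n + 1) z (Real.exp (((n + 1 : ℕ) : ℝ) * ε))
            - F z (Real.exp (((n + 1 : ℕ) : ℝ) * ε))|} < ∞) ∧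
      (∑' n : ℕ, ∫⁻ z, ENNReal.ofReal (F z (Real.exp (((n + 1 : ℕ) : ℝ) * ε))) ∂μ < ∞)) :
    ∀ᵐ p ∂(μ.prod μ),
      Tendsto
        (fun n : ℕ =>
          ENNReal.log
            ((EntranceTime.entranceTime T (EntranceTime.cylinder T P n p.2) p.1 : ℕ∞) : ℝ≥0∞)
            / ((n : ℝ) : EReal))
        atTop (𝓝 ((EntranceTime.metricEntropy μ T : ℝ≥0∞) : EReal)) := by
  open EntranceTime in
  have hTm := hT.measurable
  have hlo : ∀ q : ℚ, ENNReal.ofReal q < metricEntropy μ T → ∀ᵐ z ∂μ, ∀ᵐ x ∂μ,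
      ∀ᶠ n : ℕ in atTop, ((n * q : ℝ) : EReal) ≤
        ENNReal.log ((entranceTime T (cylinder T P n z) x : ℕ∞) : ℝ≥0∞) := by
    intro q hq
    obtain ⟨r, hr0, hqr, hr⟩ := ENNReal.lt_iff_exists_real_btwn.1 hq
    have hqr' : (q : ℝ) < r := (ENNReal.ofReal_lt_ofReal_iff'.1 hqr).1
    filter_upwards [ae_eventually_le_info_of_lt_metricEntropy hT hP hgen hr] with z hz
    exact ae_eventually_le_log_entranceTime hT.toMeasurePreserving hP hqr' hz
  have hup : ∀ q : ℚ, metricEntropy μ T < ENNReal.ofReal q → ∀ᵐ z ∂μ, ∀ᵐ x ∂μ,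
      ∀ᶠ n : ℕ in atTop, ENNReal.log ((entranceTime T (cylinder T P n z) x : ℕ∞) : ℝ≥0∞)
        ≤ ((n * q : ℝ) : EReal) := by
    intro q hq
    obtain ⟨ε₀, hε₀, hε⟩ := hsmall
    obtain ⟨r, hr0, hhr, hrq⟩ := ENNReal.lt_iff_exists_real_btwn.1 hq
    have hrq' : r < (q : ℝ) := (ENNReal.ofReal_lt_ofReal_iff'.1 hrq).1
    -- With r above the entropy, ε must be admissible for the hypotheses and leave r + ε below q.
    obtain ⟨ε, hε1, hε2⟩ := exists_between (lt_min hε₀ (sub_pos.2 hrq'))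
    obtain ⟨h1, h2⟩ := hε ε hε1 (hε2.trans_le (min_le_left _ _))
    have hεq : r + ε < q := by linarith [hε2.trans_le (min_le_right ε₀ ((q : ℝ) - r))]
    filter_upwards [ae_eventually_info_le_of_metricEntropy_lt hT hP (hH (lt_top_of_lt hhr)) hhr,
      ae_tsum_entranceDist_ne_top hFmeas (ha.mono fun z hz => hz.2) h1 h2,
      ae_all_iff.2 fun n => ae_measure_fibre_ne_zero (μ := μ) (itinerary T P n)]
      with z hz1 hz2 hz3
    simp_rw [← cylinder_eq_preimage] at hz3
    filter_upwards [ae_eventually_log_entranceTime_le hz3 hz1 hz2] with x hx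
    filter_upwards [hx] with n hn
    refine hn.trans (EReal.coe_le_coe_iff.2 ?_)
    gcongr
  refine ae_prod_of_ae_ae_right ?_ ?_
  · refine measurableSet_tendsto (𝓝 _) fun n => ?_
    exact (Measurable.of_discrete
      (f := fun m : ℕ∞ => ENNReal.log (m : ℝ≥0∞) / ((n : ℝ) : EReal))).comp
      (measurable_entranceTime_cylinder hTm hP n)
  -- Restricting to rational q leaves countably many exceptional null sets, first in z and then in
  -- x.
  · have hlo' := ae_all_iff.2 fun q => eventually_imp_distrib_left.2 (hlo q)
    have hup' := ae_all_iff.2 fun q => eventually_imp_distrib_left.2 (hup q)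
    filter_upwards [hlo', hup'] with z hz1 hz2
    filter_upwards [ae_all_iff.2 fun q => eventually_imp_distrib_left.2 (hz1 q),
      ae_all_iff.2 fun q => eventually_imp_distrib_left.2 (hz2 q)] with x hx1 hx2
    refine tendsto_ereal_div_of_eventually_mul (fun n => ?_) hx1 hx2
    rw [← ENNReal.log_one]
    refine ENNReal.log_monotone ?_
    exact_mod_cast one_le_entranceTime _ x
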